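/- Let $T\ge 1$, and let $r_t:\mathbb R^n\to\mathbb R^p$, $g_t:\mathbb R^n\to\mathbb R^d$, $G_t,H_t:\mathbb R^n\to\mathbb R^m$ ($1\le t\le T$), $h_t:\mathbb R^n\times\mathbb R^n\to\mathbb R^q$ ($1\le t\le T-1$) and $h_T:\mathbb R^n\to\mathbb R^e$ be continuously differentiable ($e=0$, i.e. no terminal equality, is allowed). Consider the MPCC in $X=(x_1,\dots,x_T)$ $$\min_X\ \tfrac12\sum_{t=1}^T\|r_t(x_t)\|^2\quad\text{s.t.}\quad h_t(x_t,x_{t+1})=0\ (t<T),\ \ h_T(x_T)=0,\ \ g_t(x_t)\le 0,\ \ 0\le G_t(x_t)\perp H_t(x_t)\ge 0,$$ and its vertical form in $w=(X,Y,Z)$, in which the complementarity constraints are replaced by $G_t(x_t)-y_t=0$, $H_t(x_t)-z_t=0$ and $(Y,Z)\in\mathcal C:=\{(Y,Z):0\le Y\perp Z\ge 0\}$. Let $\bar h(w)$ stack all equality constraints of the vertical form and $g(w)$ all inequality constraints. For penalties $\rho_{\bar h},\rho_g>0$ and multipliers $\kappa,\mu$ put $$\Phi(w)=\tfrac12\sum_t\|r_t(x_t)\|^2+\tfrac{\rho_{\bar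 h}}2\Bigl\|\bar h(w)+\tfrac{\kappa}{\rho_{\bar h}}\Bigr\|^2+\tfrac{\rho_g}2\Bigl\|\bigl(g(w)+\tfrac{\mu}{\rho_g}\bigr)_+\Bigr\|^2 .$$ **Algorithm.** Given $\kappa^0,\mu^0,w^0$, $\rho_{\bar h}^0,\rho_g^0>0$, $\gamma>1$ and $\eta\in[0,1)$, for $k=0,1,2,\dots$ (without termination test): choose safeguarded multipliers $\bar\kappa^k,\bar\mu^k$ from $\kappa^k,\mu^k$ by some safeguarding rule (e.g. componentwise clipping to fixed intervals $[\kappa_{\min},\kappa_{\max}]$ and $[0,\mu_{\max}]$); let $\Phi^k$ be $\Phi$ with $(\rho^k_{\bar h},\rho^k_g,\bar\kappa^k,\bar\mu^k)$; by an inexact solve of $\min\Phi^k(w)$ s.t. $(Y,Z)\in\mathcal C$ obtain $w^{k+1}$ with $(Y^{k+1},Z^{k+1})\in\mathcal C$; set $\kappa^{k+1}=\bar\kappa^k+\rho_{\bar h}^k\bar h(w^{k+1})$, $\mu^{k+1}=(\bar\mu^k+\rho_g^kg(w^{k+1}))_+$, $\zeta^{k+1}=\min(\mu^{k+1},-g(w^{k+1}))$.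 If $k=0$ or $\max\{\|\zeta^{k+1}\|_\infty,\|\bar h(w^{k+1})\|_\infty\}\le\eta\max\{\|\zeta^k\|_\infty,\|\bar h(w^k)\|_\infty\}$, keep both penalties; otherwise multiply both by $\gamma$. **Residual.** Let $\mathcal Q_M=\mathbb R_{++}^2\cup(\mathbb R\times\{0\})\cup(\{0\}\times\mathbb R)$, and let $\mathcal M_M(w)$ be the set of $(u,v)$ with $u_i=0$ where $Y_i>0=Z_i$, $v_i=0$ where $Y_i=0<Z_i$, and $(u_i,v_i)\in\mathcal Q_M$ where $Y_i=Z_i=0$. Let $$r_{\rm in}(w)=\inf_{(u,v)\in\mathcal M_M(w)}\max\{\|\nabla_X\Phi^k\|_\infty,\|\nabla_Y\Phi^k-u\|_\infty,\|\nabla_Z\Phi^k-v\|_\infty,\|\min(Y,0)\|_\infty,\|\min(Z,0)\|_\infty,\|Y\circ Z\|_\infty\}.$$ **Stationarity and regularity.** For an MPCC $\min f$ s.t. $g_i\le0$, $h_j=0$, $0\le G_l\perp H_l\ge0$ and a feasible point $x^\star$, let $I_{0+},I_{+0},I_{00}$ be the index sets where, at $x^\star$, $G_l=0<H_l$, $G_l>0=H_l$,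 $G_l=H_l=0$ respectively. The point $x^\star$ is *M-stationary* if there are $\lambda\ge0$ with $\lambda_ig_i(x^\star)=0$ for all $i$, $\mu$, $u$, $v$ with $u_l=0$ on $I_{+0}$, $v_l=0$ on $I_{0+}$, $(u_l,v_l)\in\mathcal Q_M$ on $I_{00}$, and $\nabla f+\sum\lambda_i\nabla g_i+\sum\mu_j\nabla h_j-\sum u_l\nabla G_l-\sum v_l\nabla H_l=0$ at $x^\star$. *MPCC-RCPLD* holds at $x^\star$ if, for some (equivalently, any) index sets $J_1$, $L_2\subseteq I_{0+}$, $L_3\subseteq I_{+0}$ such that $\{\nabla h_j\}_{J_1}\cup\{\nabla G_l\}_{L_2}\cup\{\nabla H_l\}_{L_3}$ at $x^\star$ is a basis of the span of all $\nabla h_j$, of $\nabla G_l$ ($l\in I_{0+}$) and of $\nabla H_l$ ($l\in I_{+0}$), there is $\delta>0$ such that (i) that span has constant dimension on the ball $B_\delta(x^\star)$, these index sets being kept fixed; and (ii) for all sets $I_4$ of inequalities active at $x^\star$ and all $L_5,L_6\subseteq I_{00}$: if there are multipliers $(\lambda,\mu,u,v)\neq0$ with $\lambda\ge0$, $(u_l,v_l)\in\mathcal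 Q_M$ on $I_{00}$, supported on $I_4$, $J_1$, $L_2\cup L_5$, $L_3\cup L_6$ respectively, with $\sum\lambda_i\nabla g_i+\sum\mu_j\nabla h_j-\sum u_l\nabla G_l-\sum v_l\nabla H_l=0$ at $x^\star$, then the gradients $\{\nabla g_i\}_{I_4},\{\nabla h_j\}_{J_1},\{\nabla G_l\}_{L_2\cup L_5},\{\nabla H_l\}_{L_3\cup L_6}$ are linearly dependent at every $x\in B_\delta(x^\star)$. **Theorem.** Let $\{w^k\}$ be generated by the algorithm, suppose that $(\bar\kappa^k,\bar\mu^k)$ is bounded, and suppose that $r_{\rm in}(w^{k+1})\le\varepsilon_k$ for all $k\ge0$ (with $r_{\rm in}$ computed for $\Phi^k$), where $\varepsilon_k\downarrow0$. Then: 1. for every $k$, with the Euclidean distance and $N_{\mathcal C}$ the limiting normal cone, $$\operatorname{dist}\bigl(0,\nabla\Phi^k(w^{k+1})+\{0\}\times N_{\mathcal C}(Y^{k+1},Z^{k+1})\bigr)\le\sqrt{T(n+2m)}\;\varepsilon_k;$$ 2. every accumulation point $w^\star=(X^\star,Y^\star,Z^\star)$ of $\{w^k\}$ that is feasible for the vertical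 form and at which MPCC-RCPLD holds for the vertical form is M-stationary for the vertical form, and $X^\star$ is M-stationary for the original MPCC. -/

import Mathlib

open Filter Topology

noncomputable section

/-! ## Mathematical programs with complementarity constraints -/

/-- The program
`min f(x)` subject to `g i x ≤ 0`, `h j x = 0`, `0 ≤ G l x ⊥ H l x ≥ 0` on a Euclidean space. -/
structure MPCC (ι I J L : Type) where
  f : EuclideanSpace ℝ ι → ℝ
  g : I → EuclideanSpace ℝ ι → ℝ
  h : J → EuclideanSpace ℝ ι → ℝ
  G : L → EuclideanSpace ℝ ι → ℝ
  H : L → EuclideanSpace ℝ ι → ℝ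

/-- Labels of the individual constraint functions of an MPCC. -/
inductive ConstrIdx (I J L : Type) where
  | ineq (i : I)
  | eq (j : J)
  | compG (l : L)
  | compH (l : L)

/-- The set of labels made of inequalities in `a`, equalities in `b`, functions `G l` with `l ∈ c`
and functions `H l` with `l ∈ d`. -/
def pick {I J L : Type} (a : Set I) (b : Set J) (c d : Set L) : Set (ConstrIdx I J L) :=
  ConstrIdx.ineq '' a ∪ ConstrIdx.eq '' b ∪ ConstrIdx.compG '' c ∪ ConstrIdx.compH '' d

/-- The set `ℝ₊₊² ∪ (ℝ × {0}) ∪ ({0} × ℝ)` of admissible biactive multiplier pairs. -/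
def QM : Set (ℝ × ℝ) := {p | (0 < p.1 ∧ 0 < p.2) ∨ p.1 * p.2 = 0}

namespace MPCC

variable {ι I J L : Type} (P : MPCC ι I J L)

def Feasible (x : EuclideanSpace ℝ ι) : Prop :=
  (∀ i, P.g i x ≤ 0) ∧ (∀ j, P.h j x = 0) ∧
    ∀ l, 0 ≤ P.G l x ∧ 0 ≤ P.H l x ∧ P.G l x * P.H l x = 0

/-- The active inequalities. -/
def activeIneq (x : EuclideanSpace ℝ ι) : Set I := {i | P.g i x = 0}

/-- The indices with `G = 0 < H`. -/
def idx0p (x : EuclideanSpace ℝ ι) : Set L := {l | P.G l x = 0 ∧ 0 < P.H l x}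

/-- The indices with `G > 0 = H`. -/
def idxp0 (x : EuclideanSpace ℝ ι) : Set L := {l | 0 < P.G l x ∧ P.H l x = 0}

/-- The biactive indices `G = 0 = H`. -/
def idx00 (x : EuclideanSpace ℝ ι) : Set L := {l | P.G l x = 0 ∧ P.H l x = 0}

variable [Fintype ι]

/-- The gradient at `x` of the constraint function with a given label. -/
def grad (x : EuclideanSpace ℝ ι) : ConstrIdx I J L → EuclideanSpace ℝ ι
  | .ineq i => gradient (P.g i) x
  | .eq j => gradient (P.h j) x
  | .compG l => gradient (P.G l) x
  | .compH l => gradient (P.H l) x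

/-- The gradients at `x` of the labelled constraint functions, as an indexed family, are linearly
independent. -/
def GradIndep (x : EuclideanSpace ℝ ι) (s : Set (ConstrIdx I J L)) : Prop :=
  LinearIndependent ℝ (fun c : s => P.grad x c)

/-- The span at `x` of the gradients of the labelled constraint functions. -/
def gradSpan (x : EuclideanSpace ℝ ι) (s : Set (ConstrIdx I J L)) :
    Submodule ℝ (EuclideanSpace ℝ ι) :=
  Submodule.span ℝ (P.grad x '' s)

variable [Fintype I] [Fintype J] [Fintype L]

/-- The combination `∑ λᵢ ∇gᵢ + ∑ μⱼ ∇hⱼ - ∑ uₗ ∇Gₗ - ∑ vₗ ∇Hₗ` at `x`. -/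
def gradComb (x : EuclideanSpace ℝ ι) (lam : I → ℝ) (mu : J → ℝ) (u v : L → ℝ) :
    EuclideanSpace ℝ ι :=
  ∑ i, lam i • gradient (P.g i) x + ∑ j, mu j • gradient (P.h j) x
    - ∑ l, u l • gradient (P.G l) x - ∑ l, v l • gradient (P.H l) x

/-- Mordukhovich (M-) stationarity. -/
def MStationary (x : EuclideanSpace ℝ ι) : Prop :=
  P.Feasible x ∧
  ∃ (lam : I → ℝ) (mu : J → ℝ) (u v : L → ℝ),
    gradient P.f x + P.gradComb x lam mu u v = 0 ∧
    (∀ i, 0 ≤ lam i ∧ lam i * P.g i x = 0) ∧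
    (∀ l ∈ P.idxp0 x, u l = 0) ∧
    (∀ l ∈ P.idx0p x, v l = 0) ∧
    (∀ l ∈ P.idx00 x, (u l, v l) ∈ QM)

/-- The MPCC relaxed constant positive linear dependence condition (MPCC-RCPLD) at `xs`.

With `J₁, L₂ ⊆ I₀₊, L₃ ⊆ I₊₀` selecting a basis of the span of the gradients of all equalities, of
the `G l` with `l ∈ I₀₊` and of the `H l` with `l ∈ I₊₀`: near `xs` that span has constant
dimension, and whenever a choice of active inequalities `I₄` and biactive indices `L₅`, `L₆` admits
a nonzero multiplier (supported on the selected functions, with the M-type sign pattern) for which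
the combination of gradients vanishes at `xs`, the selected gradients are linearly dependent at
every point near `xs`. -/
def RCPLD (xs : EuclideanSpace ℝ ι) : Prop :=
  ∃ (J₁ : Set J) (L₂ L₃ : Set L),
    L₂ ⊆ P.idx0p xs ∧ L₃ ⊆ P.idxp0 xs ∧
    P.GradIndep xs (pick ∅ J₁ L₂ L₃) ∧
    P.gradSpan xs (pick ∅ J₁ L₂ L₃)
      = P.gradSpan xs (pick ∅ Set.univ (P.idx0p xs) (P.idxp0 xs)) ∧
    ∃ δ > 0,
      (∀ x ∈ Metric.ball xs δ,
        Module.finrank ℝ (P.gradSpan x (pick ∅ Set.univ (P.idx0p xs) (P.idxp0 xs)))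
          = Module.finrank ℝ (P.gradSpan xs (pick ∅ Set.univ (P.idx0p xs) (P.idxp0 xs)))) ∧
      ∀ (I₄ : Set I) (L₅ L₆ : Set L),
        I₄ ⊆ P.activeIneq xs → L₅ ⊆ P.idx00 xs → L₆ ⊆ P.idx00 xs →
        (∃ (lam : I → ℝ) (mu : J → ℝ) (u v : L → ℝ),
          (∀ i, 0 ≤ lam i) ∧ (∀ l ∈ P.idx00 xs, (u l, v l) ∈ QM) ∧
          (∀ i ∉ I₄, lam i = 0) ∧ (∀ j ∉ J₁, mu j = 0) ∧
          (∀ l ∉ L₂ ∪ L₅, u l = 0) ∧ (∀ l ∉ L₃ ∪ L₆, v l = 0) ∧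
          ¬ (lam = 0 ∧ mu = 0 ∧ u = 0 ∧ v = 0) ∧
          P.gradComb xs lam mu u v = 0) →
        ∀ x ∈ Metric.ball xs δ, ¬ P.GradIndep x (pick I₄ J₁ (L₂ ∪ L₅) (L₃ ∪ L₆))

end MPCC

/-! ## The limiting normal cone -/

section NormalCone

variable {E : Type*} [NormedAddCommGroup E] [InnerProductSpace ℝ E]

/-- The regular (Fréchet) normal cone of `S` at `x`. -/
def regularNormalCone (S : Set E) (x : E) : Set E :=
  {v | ∀ c > 0, ∀ᶠ z in 𝓝[S] x, inner ℝ v (z - x) ≤ c * ‖z - x‖}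

/-- The limiting (Mordukhovich) normal cone of `S` at `x`. -/
def limitingNormalCone (S : Set E) (x : E) : Set E :=
  {v | ∃ (xs vs : ℕ → E), (∀ k, xs k ∈ S) ∧ (∀ k, vs k ∈ regularNormalCone S (xs k)) ∧
    Tendsto xs atTop (𝓝 x) ∧ Tendsto vs atTop (𝓝 v)}

end NormalCone

/-! ## The trajectory-optimization MPCC, its vertical form, and the AuLa subproblem -/

/-- Coordinates of the trajectory `X = (x_t)` over `N + 1` time steps, `x_t ∈ ℝⁿ`. -/
abbrev XIdx (N n : ℕ) := Fin (N + 1) × Fin n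

/-- Complementarity pairs: `m` at each of the `N + 1` time steps. -/
abbrev PairIdx (N m : ℕ) := Fin (N + 1) × Fin m

/-- Coordinates of `w = (X, Y, Z)`. -/
abbrev WIdx (N n m : ℕ) := XIdx N n ⊕ (PairIdx N m ⊕ PairIdx N m)

/-- Components of `h(x_t, x_{t+1})`, `t = 1, …, T - 1`, and of the terminal equality. -/
abbrev HIdx (N q e : ℕ) := (Fin N × Fin q) ⊕ Fin e

/-- Components of the stacked equalities `h̄ = [h; G - y; H - z]`. -/
abbrev HBarIdx (N q e m : ℕ) := HIdx N q e ⊕ (PairIdx N m ⊕ PairIdx N m)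

/-- Problem data with horizon `T = N + 1`: residuals `r`, coupling equalities `h`, an equality
`hT` on the terminal state (absent if `e = 0`), inequalities `g` and complementarity functions
`G`, `H`. The functions may depend on the time step. -/
structure TrajData (N n p q e d m : ℕ) where
  r : Fin (N + 1) → EuclideanSpace ℝ (Fin n) → EuclideanSpace ℝ (Fin p)
  h : Fin N → EuclideanSpace ℝ (Fin n) × EuclideanSpace ℝ (Fin n) → EuclideanSpace ℝ (Fin q)
  hT : EuclideanSpace ℝ (Fin n) → EuclideanSpace ℝ (Fin e)
  g : Fin (N + 1) → EuclideanSpace ℝ (Fin n) → EuclideanSpace ℝ (Fin d)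
  G : Fin (N + 1) → EuclideanSpace ℝ (Fin n) → EuclideanSpace ℝ (Fin m)
  H : Fin (N + 1) → EuclideanSpace ℝ (Fin n) → EuclideanSpace ℝ (Fin m)

/-- The state `x_t` of a trajectory. -/
def stateAt {N n : ℕ} (X : EuclideanSpace ℝ (XIdx N n)) (t : Fin (N + 1)) :
    EuclideanSpace ℝ (Fin n) :=
  WithLp.toLp 2 fun i => X (t, i)

/-- The `X`-block of `w = (X, Y, Z)`. -/
def xPart {N n m : ℕ} (w : EuclideanSpace ℝ (WIdx N n m)) : EuclideanSpace ℝ (XIdx N n) :=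
  WithLp.toLp 2 fun s => w (Sum.inl s)

/-- The coordinates of the `Y`-block. -/
def yPart {N n m : ℕ} (w : EuclideanSpace ℝ (WIdx N n m)) : PairIdx N m → ℝ :=
  fun s => w (Sum.inr (Sum.inl s))

/-- The coordinates of the `Z`-block. -/
def zPart {N n m : ℕ} (w : EuclideanSpace ℝ (WIdx N n m)) : PairIdx N m → ℝ :=
  fun s => w (Sum.inr (Sum.inr s))

/-- The pair `(Y, Z)` as a point of Euclidean space. -/
def yzPart {N n m : ℕ} (w : EuclideanSpace ℝ (WIdx N n m)) :
    EuclideanSpace ℝ (PairIdx N m ⊕ PairIdx N m) :=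
  WithLp.toLp 2 fun s => w (Sum.inr s)

/-- The complementarity set `𝒞 = {(Y, Z) : 0 ≤ Y ⊥ Z ≥ 0}`. -/
def complSet (S : Type) : Set (EuclideanSpace ℝ (S ⊕ S)) :=
  {a | ∀ s : S, 0 ≤ a (Sum.inl s) ∧ 0 ≤ a (Sum.inr s) ∧ a (Sum.inl s) * a (Sum.inr s) = 0}

namespace TrajData

variable {N n p q e d m : ℕ} (D : TrajData N n p q e d m)

/-- All data are continuously differentiable. -/
def Smooth : Prop :=
  (∀ t, ContDiff ℝ 1 (D.r t)) ∧ (∀ t, ContDiff ℝ 1 (D.h t)) ∧ ContDiff ℝ 1 D.hT ∧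
    (∀ t, ContDiff ℝ 1 (D.g t)) ∧ (∀ t, ContDiff ℝ 1 (D.G t)) ∧ (∀ t, ContDiff ℝ 1 (D.H t))

/-- The objective `½ ∑ₜ r(x_t)ᵀ r(x_t)`. -/
def cost (X : EuclideanSpace ℝ (XIdx N n)) : ℝ :=
  (1 / 2) * ∑ t, ‖D.r t (stateAt X t)‖ ^ 2

/-- The equality constraints of the original problem. -/
def eqFun : HIdx N q e → EuclideanSpace ℝ (XIdx N n) → ℝ
  | Sum.inl (t, j), X => D.h t (stateAt X t.castSucc, stateAt X t.succ) j
  | Sum.inr j, X => D.hT (stateAt X (Fin.last N)) j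

/-- The original problem, in the variable `X`. -/
def original : MPCC (XIdx N n) (Fin (N + 1) × Fin d) (HIdx N q e) (PairIdx N m) where
  f := D.cost
  g := fun i X => D.g i.1 (stateAt X i.1) i.2
  h := D.eqFun
  G := fun l X => D.G l.1 (stateAt X l.1) l.2
  H := fun l X => D.H l.1 (stateAt X l.1) l.2

/-- The stacked equality constraints `h̄ = [h; G - y; H - z]`. -/
def hbar : HBarIdx N q e m → EuclideanSpace ℝ (WIdx N n m) → ℝ
  | Sum.inl j, w => D.eqFun j (xPart w)
  | Sum.inr (Sum.inl l), w => D.G l.1 (stateAt (xPart w) l.1) l.2 - yPart w l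
  | Sum.inr (Sum.inr l), w => D.H l.1 (stateAt (xPart w) l.1) l.2 - zPart w l

/-- The vertical form, in the variables `w = (X, Y, Z)`, with complementarity `0 ≤ y ⊥ z ≥ 0`
imposed directly on the slack variables. -/
def vertical : MPCC (WIdx N n m) (Fin (N + 1) × Fin d) (HBarIdx N q e m) (PairIdx N m) where
  f := fun w => D.cost (xPart w)
  g := fun i w => D.g i.1 (stateAt (xPart w) i.1) i.2
  h := D.hbar
  G := fun l w => yPart w l
  H := fun l w => zPart w l

/-- The augmented Lagrangian objective `Φ`: equalities and inequalities are penalized, the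
complementarity constraints are not. -/
def aula (ρh ρg : ℝ) (κ : HBarIdx N q e m → ℝ) (μ : Fin (N + 1) × Fin d → ℝ)
    (w : EuclideanSpace ℝ (WIdx N n m)) : ℝ :=
  D.cost (xPart w)
    + ρh / 2 * ∑ j, (D.hbar j w + κ j / ρh) ^ 2
    + ρg / 2 * ∑ i, (max (D.vertical.g i w + μ i / ρg) 0) ^ 2

end TrajData

/-! ## The inner residuals -/

section Residual

variable {N n m : ℕ}

/-- The stationarity-consistent complementarity multipliers `ℳ_M(w)`. -/
def multM (w : EuclideanSpace ℝ (WIdx N n m)) :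
    Set ((PairIdx N m → ℝ) × (PairIdx N m → ℝ)) :=
  {p | ∀ l, (0 < yPart w l ∧ zPart w l = 0 → p.1 l = 0) ∧
    (yPart w l = 0 ∧ 0 < zPart w l → p.2 l = 0) ∧
    (yPart w l = 0 ∧ zPart w l = 0 → (p.1 l, p.2 l) ∈ QM)}

/-- The primal complementarity violation (all norms are sup norms). -/
def rPri (w : EuclideanSpace ℝ (WIdx N n m)) : ℝ :=
  max ‖fun l => min (yPart w l) 0‖ (max ‖fun l => min (zPart w l) 0‖
    ‖fun l => yPart w l * zPart w l‖)

/-- The KKT residual `r_in(w; u, v)` for the inner objective `Φ` (all norms are sup norms). -/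
def rInAt (Φ : EuclideanSpace ℝ (WIdx N n m) → ℝ) (w : EuclideanSpace ℝ (WIdx N n m))
    (u v : PairIdx N m → ℝ) : ℝ :=
  max ‖fun s : XIdx N n => gradient Φ w (Sum.inl s)‖
    (max ‖yPart (gradient Φ w) - u‖ (max ‖zPart (gradient Φ w) - v‖ (rPri w)))

/-- The best achievable KKT residual `r_in(w)`, the infimum of `r_in(w; u, v)` over `ℳ_M(w)`. -/
def rIn (Φ : EuclideanSpace ℝ (WIdx N n m) → ℝ) (w : EuclideanSpace ℝ (WIdx N n m)) : ℝ :=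
  ⨅ p : multM w, rInAt Φ w p.1.1 p.1.2

/-- The set `∇Φ(w) + {0} × N_𝒞(Y, Z)`. -/
def stationaritySet (Φ : EuclideanSpace ℝ (WIdx N n m) → ℝ)
    (w : EuclideanSpace ℝ (WIdx N n m)) : Set (EuclideanSpace ℝ (WIdx N n m)) :=
  {a | ∃ ν, xPart ν = 0 ∧
    yzPart ν ∈ limitingNormalCone (complSet (PairIdx N m)) (yzPart w) ∧ a = gradient Φ w + ν}

end Residual

/-! ## The safeguarded outer loop -/

/-- Componentwise clipping to `[lo, hi]`. -/
def clip {S : Type} (lo hi : ℝ) (a : S → ℝ) : S → ℝ := fun s => max lo (min hi (a s))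

/-- Clipped multipliers are bounded. -/
theorem norm_clip_le {S : Type} [Fintype S] {lo hi : ℝ} (hlh : lo ≤ hi) (a : S → ℝ) :
    ‖clip lo hi a‖ ≤ max |lo| |hi| := by
  refine (pi_norm_le_iff_of_nonneg (le_max_of_le_left (abs_nonneg lo))).2 fun s => ?_
  rw [Real.norm_eq_abs]
  exact abs_le_max_abs_abs (le_max_left _ _) (max_le hlh (min_le_left _ _))

/-- The measure `max {‖ζ‖_∞, ‖h̄(w)‖_∞}`, with `ζ = min (μ, -g)`, monitored by the penalty update. -/
def outerViolation {N n p q e d m : ℕ} (D : TrajData N n p q e d m)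
    (w : EuclideanSpace ℝ (WIdx N n m)) (μ : Fin (N + 1) × Fin d → ℝ) : ℝ :=
  max ‖fun i => min (μ i) (-(D.vertical.g i w))‖ ‖fun j => D.hbar j w‖

/-- `w, κ, κ̄, μ, μ̄, ρ_h̄, ρ_g` are generated by the safeguarded AuLa outer loop with safeguarding
rules `Sκ`, `Sμ` (such as `fun _ => clip κmin κmax` and `fun _ => clip 0 μmax`), penalty increase
factor `γ` and violation factor `η`. At iteration `k` the inner solver returns some `w (k + 1)`
satisfying the complementarity constraints exactly; its accuracy is not part of this definition. -/
structure IsSafeguardedAuLa {N n p q e d m : ℕ} (D : TrajData N n p q e d m)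
    (Sκ : ℕ → (HBarIdx N q e m → ℝ) → (HBarIdx N q e m → ℝ))
    (Sμ : ℕ → (Fin (N + 1) × Fin d → ℝ) → (Fin (N + 1) × Fin d → ℝ))
    (γ η : ℝ)
    (w : ℕ → EuclideanSpace ℝ (WIdx N n m))
    (κ κbar : ℕ → HBarIdx N q e m → ℝ) (μ μbar : ℕ → Fin (N + 1) × Fin d → ℝ)
    (ρh ρg : ℕ → ℝ) : Prop where
  penalty_pos : 0 < ρh 0 ∧ 0 < ρg 0
  safeguard : ∀ k, κbar k = Sκ k (κ k) ∧ μbar k = Sμ k (μ k)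
  hard_constraint : ∀ k, yzPart (w (k + 1)) ∈ complSet (PairIdx N m)
  update_kappa : ∀ k j, κ (k + 1) j = κbar k j + ρh k * D.hbar j (w (k + 1))
  update_mu : ∀ k i, μ (k + 1) i = max (μbar k i + ρg k * D.vertical.g i (w (k + 1))) 0
  penalty_keep : ∀ k,
    (k = 0 ∨ outerViolation D (w (k + 1)) (μ (k + 1)) ≤ η * outerViolation D (w k) (μ k)) →
      ρh (k + 1) = ρh k ∧ ρg (k + 1) = ρg k
  penalty_increase : ∀ k,
    ¬ (k = 0 ∨ outerViolation D (w (k + 1)) (μ (k + 1)) ≤ η * outerViolation D (w k) (μ k)) →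
      ρh (k + 1) = γ * ρh k ∧ ρg (k + 1) = γ * ρg k

end

/-!
A small residual yields M-type multipliers `(u, v)` for which `∇Φᵏ(wᵏ⁺¹) - (0, u, v)` is small.
Since `-(u, v)` is a limiting normal of the complementarity set, this is the distance estimate.
Since `∇Φᵏ(wᵏ⁺¹)` is the gradient of the Lagrangian at the updated multipliers, it also makes every
feasible accumulation point asymptotically M-stationary: the multipliers may be unbounded, but those
of the inactive inequalities vanish in the limit, because either the penalties diverge or the
violation measure contracts.

MPCC-RCPLD turns asymptotic into exact stationarity. A sign-preserving Carathéodory reduction moves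
the multipliers, along a subsequence, onto a fixed family of gradients that contains a basis of the
equality-type gradients and is linearly independent along the sequence. The reduced multipliers
are bounded, for otherwise their normalized limit would be a nontrivial relation at the accumulation
point, and MPCC-RCPLD would make the family dependent nearby. Finally, the slack components of
the stationarity equation identify the multipliers of `G - y = 0` and `H - z = 0` with `-u` and
`-v`, which eliminates the slacks.
-/

section LinearCombination

variable {R ι V : Type*} [Fintype ι]

theorem mem_span_image_iff_exists_linearCombination [Semiring R] [AddCommMonoid V] [Module R V]
    {A : ι → V} {s : Set ι} {x : V} :
    x ∈ Submodule.span R (A '' s) ↔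
      ∃ c : ι → R, c.support ⊆ s ∧ Fintype.linearCombination R A c = x := by
  rw [Finsupp.mem_span_image_iff_linearCombination,
    ← (Finsupp.linearEquivFunOnFinite R R ι).toEquiv.exists_congr_right]
  simp [Finsupp.mem_supported, Fintype.linearCombination_apply, Finsupp.linearCombination_apply,
    Finsupp.sum_fintype, Set.subset_def]

theorem exists_linearCombination_eq_of_span_le [Semiring R]
    [AddCommMonoid V] [Module R V] {A : ι → V} {B E : Set ι} (hBE : B ⊆ E)
    (hspan : Submodule.span R (A '' E) ≤ Submodule.span R (A '' B)) (a : ι → R) :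
    ∃ a' : ι → R, Fintype.linearCombination R A a' = Fintype.linearCombination R A a ∧
      (∀ i ∈ E \ B, a' i = 0) ∧ ∀ i ∉ E, a' i = a i := by
  classical
  obtain ⟨b, hb, hsum⟩ := mem_span_image_iff_exists_linearCombination.1
    (hspan (mem_span_image_iff_exists_linearCombination.2
      ⟨E.indicator a, Set.support_indicator_subset, rfl⟩))
  have hb0 : ∀ i ∉ B, b i = 0 := Function.support_subset_iff'.1 hb
  refine ⟨b + Eᶜ.indicator a, ?_, fun i hi => by simp [hb0 i hi.2, hi.1], fun i hi => ?_⟩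
  · rw [map_add, hsum, ← map_add, Set.indicator_self_add_compl]
  · simp [hb0 i fun h => hi (hBE h), hi]

theorem linearIndepOn_iff_linearCombination_eq_zero [Ring R] [AddCommGroup V] [Module R V]
    {A : ι → V} {s : Set ι} :
    LinearIndepOn R A s ↔
      ∀ c : ι → R, c.support ⊆ s → Fintype.linearCombination R A c = 0 → c = 0 := by
  rw [linearIndepOn_iff, ← (Finsupp.linearEquivFunOnFinite R R ι).toEquiv.forall_congr_right]
  simp [Finsupp.mem_supported, Fintype.linearCombination_apply, Finsupp.linearCombination_apply,
    Finsupp.sum_fintype, Set.subset_def]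

end LinearCombination

theorem finrank_span_image_eq_ncard {K ι V : Type*} [DivisionRing K] [AddCommGroup V] [Module K V]
    {A : ι → V} {B : Set ι} (hB : LinearIndepOn K A B) :
    Module.finrank K (Submodule.span K (A '' B)) = B.ncard := by
  rw [← hB.injOn.ncard_image, Set.image_eq_range, Module.finrank, rank_span hB]
  rfl

section ConformalReduction

variable {𝕜 ι V : Type*} [Field 𝕜] [LinearOrder 𝕜]

/-- A scalar `a'` conforms to `a` if it vanishes or has the same sign as `a`; this is the relation
between the coefficients before and after a sign-preserving Carathéodory reduction. -/
def Conforms (a' a : 𝕜) : Prop := a' = 0 ∨ SignType.sign a' = SignType.sign a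

namespace Conforms

theorem refl (a : 𝕜) : Conforms a a := Or.inr rfl

theorem trans {a b c : 𝕜} (hab : Conforms a b) (hbc : Conforms b c) : Conforms a c := by
  rcases hab with ha | hab
  · exact Or.inl ha
  rcases hbc with hb | hbc
  · exact Or.inl (sign_eq_zero_iff.1 (by rw [hab, hb, sign_zero]))
  · exact Or.inr (hab.trans hbc)

theorem eq_zero {a' a : 𝕜} (h : Conforms a' a) (ha : a = 0) : a' = 0 :=
  h.elim id fun hs => sign_eq_zero_iff.1 (by rw [hs, ha, sign_zero])

theorem nonneg {a' a : 𝕜} (h : Conforms a' a) (ha : 0 ≤ a) : 0 ≤ a' :=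
  h.elim ge_of_eq fun hs => sign_nonneg_iff.1 (hs ▸ sign_nonneg_iff.2 ha)

theorem neg [IsStrictOrderedRing 𝕜] {a' a : 𝕜} (h : Conforms a' a) : Conforms (-a') (-a) :=
  h.imp neg_eq_zero.2 fun hs => by rw [Left.sign_neg, Left.sign_neg, hs]

theorem sub_of_abs_le [IsStrictOrderedRing 𝕜] {a s : 𝕜} (h : |s| ≤ |a|) : Conforms (a - s) a := by
  rcases eq_or_ne (a - s) 0 with h₀ | h₀
  · exact Or.inl h₀
  right
  rcases lt_trichotomy a 0 with ha | rfl | ha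
  · have : a ≤ s := by rw [abs_of_neg ha] at h; linarith [neg_abs_le s]
    rw [sign_neg ha, sign_neg (lt_of_le_of_ne (sub_nonpos.2 this) h₀)]
  · simp_all
  · have : s ≤ a := (le_abs_self s).trans (h.trans_eq (abs_of_pos ha))
    rw [sign_pos ha, sign_pos (lt_of_le_of_ne (sub_nonneg.2 this) h₀.symm)]

end Conforms

theorem exists_mul_eq_and_abs_mul_le [IsStrictOrderedRing 𝕜] {s : Set ι} (hs : s.Finite)
    (a c : ι → 𝕜) (hc : ∃ j ∈ s, c j ≠ 0) :
    ∃ t : 𝕜, (∃ j ∈ s, c j ≠ 0 ∧ t * c j = a j) ∧ ∀ i ∈ s, |t * c i| ≤ |a i| := by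
  obtain ⟨j, ⟨hjs, hcj⟩, hmin⟩ := Set.exists_min_image {i ∈ s | c i ≠ 0} (fun i => |a i / c i|)
    (hs.subset fun _ hi => hi.1) hc
  refine ⟨a j / c j, ⟨j, hjs, hcj, div_mul_cancel₀ _ hcj⟩, fun i hi => ?_⟩
  rcases eq_or_ne (c i) 0 with hci | hci
  · simp [hci]
  · have := hmin i ⟨hi, hci⟩
    rwa [abs_div (a i), le_div_iff₀ (abs_pos.2 hci), ← abs_mul] at this

variable [IsStrictOrderedRing 𝕜] [Fintype ι] [AddCommGroup V] [Module 𝕜 V] {A : ι → V}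
  {B E : Set ι}

theorem exists_conforms_linearIndepOn (hB : LinearIndepOn 𝕜 A B) (a : ι → 𝕜) :
    ∃ a' : ι → 𝕜, Fintype.linearCombination 𝕜 A a' = Fintype.linearCombination 𝕜 A a ∧
      (∀ i ∉ B, Conforms (a' i) (a i)) ∧ LinearIndepOn 𝕜 A (B ∪ a'.support) := by
  -- Take `a'` of minimal support off `B`; a dependence would allow removing another index.
  obtain ⟨a', ⟨hsum, hconf⟩, hmin⟩ := exists_minimalFor_of_wellFoundedLT
    (fun a' : ι → 𝕜 => Fintype.linearCombination 𝕜 A a' = Fintype.linearCombination 𝕜 A a ∧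
      ∀ i ∉ B, Conforms (a' i) (a i))
    (fun a' => a'.support \ B) ⟨a, rfl, fun i _ => Conforms.refl (a i)⟩
  refine ⟨a', hsum, hconf, linearIndepOn_iff_linearCombination_eq_zero.2 fun c hc hc0 => ?_⟩
  by_contra hne
  have hoff : ∃ j ∈ Bᶜ, c j ≠ 0 := by
    by_contra! hcB
    exact hne (linearIndepOn_iff_linearCombination_eq_zero.1 hB c
      (Function.support_subset_iff'.2 hcB) hc0)
  obtain ⟨t, ⟨j, hjB, hcj, htj⟩, hle⟩ := exists_mul_eq_and_abs_mul_le (Set.toFinite Bᶜ) a' c hoff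
  have hconf' : ∀ i ∉ B, Conforms ((a' - t • c) i) (a' i) :=
    fun i hi => Conforms.sub_of_abs_le (hle i hi)
  have hsub : (a' - t • c).support \ B ⊆ a'.support \ B := fun i hi =>
    ⟨fun h0 => hi.1 ((hconf' i hi.2).eq_zero h0), hi.2⟩
  have hj : j ∈ a'.support \ B := ⟨(hc hcj).resolve_left hjB, hjB⟩
  refine (hmin ⟨?_, fun i hi => (hconf' i hi).trans (hconf i hi)⟩ hsub hj).1 ?_
  · rw [map_sub, map_smul, hc0, smul_zero, sub_zero, hsum]
  · simp [htj]

theorem exists_conforms_linearIndepOn_of_span_le (hBE : B ⊆ E) (hB : LinearIndepOn 𝕜 A B)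
    (hspan : Submodule.span 𝕜 (A '' E) ≤ Submodule.span 𝕜 (A '' B)) (a : ι → 𝕜) :
    ∃ a' : ι → 𝕜, Fintype.linearCombination 𝕜 A a' = Fintype.linearCombination 𝕜 A a ∧
      (∀ i ∈ E \ B, a' i = 0) ∧ (∀ i ∉ E, Conforms (a' i) (a i)) ∧
      LinearIndepOn 𝕜 A (B ∪ a'.support) := by
  obtain ⟨b, hsum, hbE, hb⟩ := exists_linearCombination_eq_of_span_le hBE hspan a
  obtain ⟨a', hsum', hconf, hind⟩ := exists_conforms_linearIndepOn hB b
  exact ⟨a', hsum'.trans hsum, fun i hi => (hconf i hi.2).eq_zero (hbE i hi),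
    fun i hi => hb i hi ▸ hconf i fun h => hi (hBE h), hind⟩

end ConformalReduction

section Limits

variable {𝕜 ι V α : Type*} [NontriviallyNormedField 𝕜] [NormedAddCommGroup V]
  [NormedSpace 𝕜 V] {l : Filter α} {A : α → ι → V} {A₀ : ι → V}

theorem tendsto_linearCombination [Fintype ι] (hA : Tendsto A l (𝓝 A₀)) {a : α → ι → 𝕜} {a₀ : ι → 𝕜}
    (ha : Tendsto a l (𝓝 a₀)) :
    Tendsto (fun x => Fintype.linearCombination 𝕜 (A x) (a x)) l
      (𝓝 (Fintype.linearCombination 𝕜 A₀ a₀)) :=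
  tendsto_finsetSum _ fun i _ => (tendsto_pi_nhds.1 ha i).smul (tendsto_pi_nhds.1 hA i)

theorem eventually_linearIndepOn_and_span_le [CompleteSpace 𝕜] [Finite ι]
    (hA : Tendsto A l (𝓝 A₀)) {B E : Set ι} (hBE : B ⊆ E) (hB : LinearIndepOn 𝕜 A₀ B)
    (hspan : Submodule.span 𝕜 (A₀ '' B) = Submodule.span 𝕜 (A₀ '' E))
    (hrank : ∀ᶠ x in l, Module.finrank 𝕜 (Submodule.span 𝕜 (A x '' E)) =
      Module.finrank 𝕜 (Submodule.span 𝕜 (A₀ '' E))) :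
    ∀ᶠ x in l, LinearIndepOn 𝕜 (A x) B ∧
      Submodule.span 𝕜 (A x '' E) ≤ Submodule.span 𝕜 (A x '' B) := by
  have hres : Tendsto (fun x (i : B) => A x i) l (𝓝 fun i : B => A₀ i) :=
    tendsto_pi_nhds.2 fun i => tendsto_pi_nhds.1 hA i
  filter_upwards [hres.eventually (isOpen_setOfPred_linearIndependent.mem_nhds hB), hrank]
    with x (hx : LinearIndepOn 𝕜 (A x) B) hr
  have : FiniteDimensional 𝕜 (Submodule.span 𝕜 (A x '' E)) :=
    FiniteDimensional.span_of_finite 𝕜 (Set.toFinite _)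
  refine ⟨hx, (Submodule.eq_of_le_of_finrank_eq (Submodule.span_mono (Set.image_mono hBE)) ?_).ge⟩
  rw [hr, ← hspan, finrank_span_image_eq_ncard hx, finrank_span_image_eq_ncard hB]

theorem exists_limit_multiplier [Fintype ι] [NormedSpace ℝ V] {A : ℕ → ι → V}
    (hA : Tendsto A atTop (𝓝 A₀)) {b : ℕ → V} {b₀ : V} (hb : Tendsto b atTop (𝓝 b₀))
    {K : Set (ι → ℝ)} (hK : IsClosed K) (hcone : ∀ t : ℝ, 0 < t → ∀ a ∈ K, t • a ∈ K)
    {a : ℕ → ι → ℝ} (ha : ∀ k, a k ∈ K)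
    (hlim : Tendsto (fun k => b k + Fintype.linearCombination ℝ (A k) (a k)) atTop (𝓝 0)) :
    (∃ a₀ ∈ K, b₀ + Fintype.linearCombination ℝ A₀ a₀ = 0) ∨
      ∃ a₀ ∈ K, a₀ ≠ 0 ∧ Fintype.linearCombination ℝ A₀ a₀ = 0 := by
  -- The normalized multipliers `(1, a k)` accumulate at some `(τ, a₀) ≠ 0`; split on `τ = 0`.
  set r : ℕ → ℝ := fun k => ‖((1, a k) : ℝ × (ι → ℝ))‖⁻¹
  have hne : ∀ k, ((1, a k) : ℝ × (ι → ℝ)) ≠ 0 := fun k h => one_ne_zero (congrArg Prod.fst h)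
  have hr0 : ∀ k, 0 < r k := fun k => inv_pos.2 (norm_pos_iff.2 (hne k))
  have hsphere : ∀ k, r k • ((1, a k) : ℝ × (ι → ℝ)) ∈ Metric.sphere 0 1 := fun k => by
    exact mem_sphere_zero_iff_norm.2 (norm_smul_inv_norm (𝕜 := ℝ) (hne k))
  obtain ⟨⟨τ, a₀⟩, hnorm, φ, hφ, hlimφ⟩ := (isCompact_sphere _ _).tendsto_subseq hsphere
  obtain ⟨hτ, ha₀⟩ := (Prod.tendsto_iff _ _).1 hlimφ
  have hmem : a₀ ∈ K := hK.mem_of_tendsto ha₀ (.of_forall fun k => hcone _ (hr0 _) _ (ha _))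
  have hzero : τ • b₀ + Fintype.linearCombination ℝ A₀ a₀ = 0 := by
    have hscaled := hτ.smul (hlim.comp hφ.tendsto_atTop)
    rw [smul_zero] at hscaled
    refine tendsto_nhds_unique ((hτ.smul (hb.comp hφ.tendsto_atTop)).add
      (tendsto_linearCombination (hA.comp hφ.tendsto_atTop) ha₀)) (hscaled.congr fun k => ?_)
    simp only [Function.comp_apply, Prod.smul_mk, smul_eq_mul, mul_one, smul_add, map_smul]
  have hτ0 : 0 ≤ τ := ge_of_tendsto hτ (.of_forall fun k => by simpa using (hr0 _).le)
  rcases hτ0.eq_or_lt with rfl | hτ0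
  · refine Or.inr ⟨a₀, hmem, ?_, by simpa using hzero⟩
    rintro rfl
    simp at hnorm
  · refine Or.inl ⟨τ⁻¹ • a₀, hcone _ (inv_pos.2 hτ0) _ hmem, ?_⟩
    rw [map_smul, ← smul_right_injective V hτ0.ne' |>.eq_iff]
    simpa [hτ0.ne'] using hzero

end Limits

theorem isClosed_QM : IsClosed QM := by
  have hQM : QM = {p : ℝ × ℝ | 0 ≤ p.1 ∧ 0 ≤ p.2} ∪ {p : ℝ × ℝ | p.1 * p.2 = 0} := by
    ext p
    simp only [QM, Set.mem_ofPred_eq, Set.mem_union, mul_eq_zero, le_iff_eq_or_lt]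
    tauto
  rw [hQM]
  exact ((isClosed_le continuous_const continuous_fst).inter
    (isClosed_le continuous_const continuous_snd)).union
      (isClosed_eq (continuous_fst.mul continuous_snd) continuous_const)

theorem mem_QM_of_conforms {a b a' b' : ℝ} (h : (a, b) ∈ QM) (ha : Conforms a' a)
    (hb : Conforms b' b) : (a', b') ∈ QM := by
  rcases ha with rfl | ha
  · exact Or.inr (zero_mul _)
  rcases hb with rfl | hb
  · exact Or.inr (mul_zero _)
  simp only [QM, Set.mem_ofPred_eq, ← sign_eq_one_iff, ← sign_eq_zero_iff (α := ℝ), sign_mul]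
    at h ⊢
  rwa [ha, hb]

theorem conforms_mul_left {t : ℝ} (ht : 0 < t) (a : ℝ) : Conforms (t * a) a :=
  Or.inr (by rw [sign_mul, sign_pos ht, one_mul])

namespace ConstrIdx

variable {I J L : Type}

/-- The labels as a disjoint union of the index types of the four kinds of constraints. -/
def equivSum : ConstrIdx I J L ≃ (I ⊕ J) ⊕ (L ⊕ L) where
  toFun
    | ineq i => .inl (.inl i)
    | eq j => .inl (.inr j)
    | compG l => .inr (.inl l)
    | compH l => .inr (.inr l)
  invFun
    | .inl (.inl i) => ineq i
    | .inl (.inr j) => eq j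
    | .inr (.inl l) => compG l
    | .inr (.inr l) => compH l
  left_inv c := by cases c <;> rfl
  right_inv s := by rcases s with (_ | _) | (_ | _) <;> rfl

instance [Fintype I] [Fintype J] [Fintype L] : Fintype (ConstrIdx I J L) :=
  Fintype.ofEquiv _ equivSum.symm

theorem sum_eq [Fintype I] [Fintype J] [Fintype L] {M : Type*} [AddCommMonoid M]
    (f : ConstrIdx I J L → M) :
    ∑ c, f c = ∑ i, f (ineq i) + ∑ j, f (eq j) + (∑ l, f (compG l) + ∑ l, f (compH l)) := by
  rw [← equivSum.symm.sum_comp, Fintype.sum_sum_type, Fintype.sum_sum_type, Fintype.sum_sum_type]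
  rfl

/-- The multiplier vector whose combination of the gradients is `MPCC.gradComb`; there the
complementarity multipliers enter with a minus sign. -/
def coeff (lam : I → ℝ) (mu : J → ℝ) (u v : L → ℝ) : ConstrIdx I J L → ℝ
  | ineq i => lam i
  | eq j => mu j
  | compG l => -u l
  | compH l => -v l

theorem coeff_eta (a : ConstrIdx I J L → ℝ) :
    coeff (fun i => a (ineq i)) (fun j => a (eq j)) (fun l => -a (compG l))
      (fun l => -a (compH l)) = a := by
  funext c
  cases c <;> simp [coeff]

section Pick

variable {a : Set I} {b : Set J} {s t K : Set L}

@[simp] theorem ineq_mem_pick {i : I} : ineq i ∈ pick a b s t ↔ i ∈ a := by simp [pick]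
@[simp] theorem eq_mem_pick {j : J} : eq j ∈ pick a b s t ↔ j ∈ b := by simp [pick]
@[simp] theorem compG_mem_pick {l : L} : compG l ∈ pick a b s t ↔ l ∈ s := by simp [pick]
@[simp] theorem compH_mem_pick {l : L} : compH l ∈ pick a b s t ↔ l ∈ t := by simp [pick]

theorem pick_eq_of_subset {S : Set (ConstrIdx I J L)} (hS : pick ∅ b s t ⊆ S)
    (hS' : S ⊆ pick ∅ b s t ∪ pick a ∅ K K) :
    pick (ineq ⁻¹' S) b (s ∪ compG ⁻¹' S ∩ K) (t ∪ compH ⁻¹' S ∩ K) = S := by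
  ext c
  have h := @hS c
  have h' := @hS' c
  cases c <;> simp only [Set.mem_union, Set.mem_inter_iff, Set.mem_preimage,
    Set.mem_empty_iff_false, ineq_mem_pick, eq_mem_pick, compG_mem_pick,
    compH_mem_pick] at h h' ⊢ <;> tauto

end Pick

end ConstrIdx

namespace MPCC

open ConstrIdx

section SignCone

variable {ι I J L : Type} (P : MPCC ι I J L)

/-- The labels of the constraints that behave as equalities near a feasible point `x`. -/
def equalityIdx (x : EuclideanSpace ℝ ι) : Set (ConstrIdx I J L) :=
  pick ∅ Set.univ (P.idx0p x) (P.idxp0 x)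

/-- The labels of the constraints active at `x` whose M-multipliers are restricted in sign. -/
def signedIdx (x : EuclideanSpace ℝ ι) : Set (ConstrIdx I J L) :=
  pick (P.activeIneq x) ∅ (P.idx00 x) (P.idx00 x)

/-- The multipliers, in the sign convention of `ConstrIdx.coeff`, that have the M-type sign pattern
at `x` and are supported on `S`. -/
def signCone (x : EuclideanSpace ℝ ι) (S : Set (ConstrIdx I J L)) : Set (ConstrIdx I J L → ℝ) :=
  {a | (∀ i, 0 ≤ a (ineq i)) ∧ (∀ l ∈ P.idx00 x, (-a (compG l), -a (compH l)) ∈ QM) ∧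
    a.support ⊆ S}

variable {x : EuclideanSpace ℝ ι} {S S' : Set (ConstrIdx I J L)} {a a' : ConstrIdx I J L → ℝ}

theorem isClosed_signCone : IsClosed (P.signCone x S) := by
  have hineq : IsClosed {a : ConstrIdx I J L → ℝ | ∀ i, 0 ≤ a (ineq i)} := by
    simp only [Set.ofPred_forall]
    exact isClosed_iInter fun i => isClosed_le continuous_const (continuous_apply _)
  have hpair : IsClosed {a : ConstrIdx I J L → ℝ |
      ∀ l ∈ P.idx00 x, (-a (compG l), -a (compH l)) ∈ QM} := by
    simp only [Set.ofPred_forall]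
    exact isClosed_iInter fun l => isClosed_iInter fun _ => isClosed_QM.preimage
      ((continuous_apply _).neg.prodMk (continuous_apply _).neg)
  have hsupp : IsClosed {a : ConstrIdx I J L → ℝ | a.support ⊆ S} := by
    simp only [Function.support_subset_iff', Set.ofPred_forall]
    exact isClosed_iInter fun c => isClosed_iInter fun _ =>
      isClosed_eq (continuous_apply _) continuous_const
  exact hineq.inter (hpair.inter hsupp)

variable {P}

theorem mem_signCone_of_conforms (ha : a ∈ P.signCone x S)
    (hconf : ∀ c ∉ P.equalityIdx x, Conforms (a' c) (a c)) (hS' : a'.support ⊆ S') :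
    a' ∈ P.signCone x S' := by
  refine ⟨fun i => (hconf _ (by simp [equalityIdx])).nonneg (ha.1 i), fun l hl => ?_, hS'⟩
  exact mem_QM_of_conforms (ha.2.1 l hl)
    (hconf (compG l) (by simp [equalityIdx, idx0p, hl.2])).neg
    (hconf (compH l) (by simp [equalityIdx, idxp0, hl.1])).neg

theorem smul_mem_signCone {t : ℝ} (ht : 0 < t) (ha : a ∈ P.signCone x S) :
    t • a ∈ P.signCone x S :=
  mem_signCone_of_conforms ha (fun c _ => conforms_mul_left ht (a c))
    ((Function.support_const_smul_subset t a).trans ha.2.2)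

theorem Feasible.mem_idx (hx : P.Feasible x) (l : L) :
    l ∈ P.idx0p x ∨ l ∈ P.idxp0 x ∨ l ∈ P.idx00 x := by
  obtain ⟨hG, hH, hGH⟩ := hx.2.2 l
  simp only [idx0p, idxp0, idx00, Set.mem_ofPred_eq, hG.lt_iff_ne', hH.lt_iff_ne']
  rw [mul_eq_zero] at hGH
  tauto

theorem Feasible.coeff_mem_signCone (hx : P.Feasible x) {lam : I → ℝ} {u v : L → ℝ}
    (hlam : ∀ i, 0 ≤ lam i) (hinact : ∀ i ∉ P.activeIneq x, lam i = 0)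
    (hu : ∀ l ∈ P.idxp0 x, u l = 0) (hv : ∀ l ∈ P.idx0p x, v l = 0)
    (hQM : ∀ l ∈ P.idx00 x, (u l, v l) ∈ QM) (mu : J → ℝ) :
    coeff lam mu u v ∈ P.signCone x (P.equalityIdx x ∪ P.signedIdx x) := by
  refine ⟨hlam, by simpa [coeff] using hQM, Function.support_subset_iff'.2 fun c hc => ?_⟩
  simp only [equalityIdx, signedIdx, Set.mem_union, not_or] at hc
  cases c with
  | ineq i => exact hinact i (by simpa using hc.2)
  | eq j => simp at hc
  | compG l =>
    simp only [compG_mem_pick] at hc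
    exact neg_eq_zero.2 (hu l (((hx.mem_idx l).resolve_left hc.1).resolve_right hc.2))
  | compH l =>
    simp only [compH_mem_pick] at hc
    exact neg_eq_zero.2 (hv l ((hx.mem_idx l).resolve_right fun h => h.elim hc.1 hc.2))

end SignCone

section Stationarity

variable {ι I J L : Type} [Fintype ι] [Fintype I] [Fintype J] [Fintype L] {P : MPCC ι I J L}
  {xs : EuclideanSpace ℝ ι}

theorem gradComb_eq_linearCombination (x : EuclideanSpace ℝ ι) (lam : I → ℝ) (mu : J → ℝ)
    (u v : L → ℝ) :
    P.gradComb x lam mu u v = Fintype.linearCombination ℝ (P.grad x) (coeff lam mu u v) := by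
  rw [Fintype.linearCombination_apply, ConstrIdx.sum_eq]
  simp only [gradComb, coeff, grad, neg_smul, Finset.sum_neg_distrib]
  abel

theorem mStationary_of_mem_signCone (hfeas : P.Feasible xs) {a : ConstrIdx I J L → ℝ}
    (ha : a ∈ P.signCone xs (P.equalityIdx xs ∪ P.signedIdx xs))
    (hsum : gradient P.f xs + Fintype.linearCombination ℝ (P.grad xs) a = 0) :
    P.MStationary xs := by
  have hzero : ∀ c ∉ P.equalityIdx xs ∪ P.signedIdx xs, a c = 0 :=
    Function.support_subset_iff'.1 ha.2.2
  refine ⟨hfeas, fun i => a (ineq i), fun j => a (eq j), fun l => -a (compG l),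
    fun l => -a (compH l), by rwa [gradComb_eq_linearCombination, coeff_eta],
    fun i => ⟨ha.1 i, ?_⟩, fun l hl => ?_, fun l hl => ?_, ha.2.1⟩
  · rcases eq_or_ne (P.g i xs) 0 with hi | hi
    · rw [hi, mul_zero]
    · have hai : a (ineq i) = 0 := hzero _ (by simp [equalityIdx, signedIdx, activeIneq, hi])
      exact mul_eq_zero_of_left hai _
  · exact neg_eq_zero.2 (hzero _ (by simp [equalityIdx, signedIdx, idx0p, idx00, hl.1.ne']))
  · exact neg_eq_zero.2 (hzero _ (by simp [equalityIdx, signedIdx, idxp0, idx00, hl.2.ne']))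

theorem RCPLD.exists_basis (hR : P.RCPLD xs) :
    ∃ B ⊆ P.equalityIdx xs, LinearIndepOn ℝ (P.grad xs) B ∧
      P.gradSpan xs B = P.gradSpan xs (P.equalityIdx xs) ∧
      (∀ᶠ x in 𝓝 xs, Module.finrank ℝ (P.gradSpan x (P.equalityIdx xs)) =
        Module.finrank ℝ (P.gradSpan xs (P.equalityIdx xs))) ∧
      ∀ S, B ⊆ S → S ⊆ B ∪ P.signedIdx xs →
        (∃ a ∈ P.signCone xs S, a ≠ 0 ∧ Fintype.linearCombination ℝ (P.grad xs) a = 0) →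
        ∀ᶠ x in 𝓝 xs, ¬ LinearIndepOn ℝ (P.grad x) S := by
  obtain ⟨J₁, L₂, L₃, hL₂, hL₃, hind, hspan, δ, hδ, hrank, hdep⟩ := hR
  have hball := Metric.ball_mem_nhds xs hδ
  refine ⟨pick ∅ J₁ L₂ L₃, fun c hc => ?_, hind, hspan, Filter.mem_of_superset hball hrank,
    fun S hBS hSB ⟨a, ha, hne, hsum⟩ => ?_⟩
  · cases c with
    | ineq i => simp at hc
    | eq j => simp [equalityIdx]
    | compG l => exact compG_mem_pick.2 (hL₂ (compG_mem_pick.1 hc))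
    | compH l => exact compH_mem_pick.2 (hL₃ (compH_mem_pick.1 hc))
  have hS := pick_eq_of_subset hBS hSB
  have hzero : ∀ c ∉ S, a c = 0 := Function.support_subset_iff'.1 ha.2.2
  filter_upwards [hball] with x hx
  rw [← hS]
  refine hdep _ _ _ (fun i hi => ?_) Set.inter_subset_right Set.inter_subset_right
    ⟨fun i => a (ineq i), fun j => a (eq j), fun l => -a (compG l), fun l => -a (compH l),
      ha.1, ha.2.1, fun i hi => hzero _ hi, fun j hj => hzero _ ?_,
      fun l hl => neg_eq_zero.2 (hzero _ ?_), fun l hl => neg_eq_zero.2 (hzero _ ?_), ?_,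
      by rwa [gradComb_eq_linearCombination, coeff_eta]⟩ x hx
  · simpa [signedIdx] using hSB hi
  · rwa [← hS, eq_mem_pick]
  · rwa [← hS, compG_mem_pick]
  · rwa [← hS, compH_mem_pick]
  · rintro ⟨hlam, hmu, hu, hv⟩
    refine hne (funext fun c => ?_)
    cases c with
    | ineq i => exact congrFun hlam i
    | eq j => exact congrFun hmu j
    | compG l => exact neg_eq_zero.1 (congrFun hu l)
    | compH l => exact neg_eq_zero.1 (congrFun hv l)

theorem eventually_exists_linearIndepOn_signCone (hgrad : ContinuousAt P.grad xs)
    {B : Set (ConstrIdx I J L)} (hBE : B ⊆ P.equalityIdx xs)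
    (hB : LinearIndepOn ℝ (P.grad xs) B)
    (hspan : P.gradSpan xs B = P.gradSpan xs (P.equalityIdx xs))
    (hrank : ∀ᶠ x in 𝓝 xs, Module.finrank ℝ (P.gradSpan x (P.equalityIdx xs)) =
      Module.finrank ℝ (P.gradSpan xs (P.equalityIdx xs))) :
    ∀ᶠ x in 𝓝 xs, ∀ a ∈ P.signCone xs (P.equalityIdx xs ∪ P.signedIdx xs),
      ∃ S, B ⊆ S ∧ S ⊆ B ∪ P.signedIdx xs ∧ LinearIndepOn ℝ (P.grad x) S ∧
        ∃ a' ∈ P.signCone xs S, Fintype.linearCombination ℝ (P.grad x) a' =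
          Fintype.linearCombination ℝ (P.grad x) a := by
  filter_upwards [eventually_linearIndepOn_and_span_le hgrad hBE hB hspan hrank]
    with x ⟨hBx, hspanx⟩ a ha
  obtain ⟨a', hsum, hzero, hconf, hind⟩ :=
    exists_conforms_linearIndepOn_of_span_le hBE hBx hspanx a
  refine ⟨B ∪ a'.support, Set.subset_union_left, ?_, hind, a',
    mem_signCone_of_conforms ha hconf Set.subset_union_right, hsum⟩
  refine Set.union_subset Set.subset_union_left (Function.support_subset_iff'.2 fun c hc => ?_)
  rw [Set.mem_union, not_or] at hc
  by_cases hcE : c ∈ P.equalityIdx xs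
  · exact hzero c ⟨hcE, hc.1⟩
  · exact (hconf c hcE).eq_zero (Function.support_subset_iff'.1 ha.2.2 c (by simp [hcE, hc.2]))

variable (P) in
/-- Asymptotic M-stationarity: along some sequence converging to `xs`, the Lagrangian gradient for
multipliers with the sign pattern of M-stationarity at `xs` tends to zero. -/
def AMStationary (xs : EuclideanSpace ℝ ι) : Prop :=
  ∃ (x : ℕ → EuclideanSpace ℝ ι) (a : ℕ → ConstrIdx I J L → ℝ),
    Tendsto x atTop (𝓝 xs) ∧
    (∀ᶠ k in atTop, a k ∈ P.signCone xs (P.equalityIdx xs ∪ P.signedIdx xs)) ∧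
    Tendsto (fun k => gradient P.f (x k) + Fintype.linearCombination ℝ (P.grad (x k)) (a k))
      atTop (𝓝 0)

theorem AMStationary.mStationary (hA : P.AMStationary xs) (hfeas : P.Feasible xs)
    (hR : P.RCPLD xs) (hf : ContinuousAt (gradient P.f) xs) (hgrad : ContinuousAt P.grad xs) :
    P.MStationary xs := by
  obtain ⟨x, a, hx, ha, hlim⟩ := hA
  obtain ⟨B, hBE, hB, hspan, hrank, hdep⟩ := hR.exists_basis
  have hreduce : ∀ᶠ k in atTop, ∃ S, B ⊆ S ∧ S ⊆ B ∪ P.signedIdx xs ∧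
      LinearIndepOn ℝ (P.grad (x k)) S ∧ ∃ a' ∈ P.signCone xs S,
        Fintype.linearCombination ℝ (P.grad (x k)) a' =
          Fintype.linearCombination ℝ (P.grad (x k)) (a k) := by
    filter_upwards [hx.eventually (eventually_exists_linearIndepOn_signCone hgrad hBE hB hspan
      hrank), ha] with k hk hak using hk _ hak
  obtain ⟨S, hfreq⟩ := frequently_exists.1 hreduce.frequently
  obtain ⟨φ, hφ, hφS⟩ := extraction_of_frequently_atTop hfreq
  have hBS : B ⊆ S := (hφS 0).1
  have hSB : S ⊆ B ∪ P.signedIdx xs := (hφS 0).2.1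
  choose hind a' ha' hsum using fun k => (hφS k).2.2
  have hxφ : Tendsto (x ∘ φ) atTop (𝓝 xs) := hx.comp hφ.tendsto_atTop
  have hlimφ : Tendsto (fun k => gradient P.f (x (φ k)) +
      Fintype.linearCombination ℝ (P.grad (x (φ k))) (a' k)) atTop (𝓝 0) := by
    simp only [hsum]
    exact hlim.comp hφ.tendsto_atTop
  rcases exists_limit_multiplier (hgrad.tendsto.comp hxφ) (hf.tendsto.comp hxφ)
    P.isClosed_signCone (fun t ht a ha => smul_mem_signCone ht ha) ha' hlimφ with
    ⟨a₀, ha₀, hzero⟩ | hrel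
  · exact mStationary_of_mem_signCone hfeas
      ⟨ha₀.1, ha₀.2.1, ha₀.2.2.trans (hSB.trans (Set.union_subset_union_left _ hBE))⟩ hzero
  · obtain ⟨k, hk⟩ := (hxφ.eventually (hdep S hBS hSB hrel)).exists
    exact absurd (hind k) hk

theorem amStationary_of_tendsto (hfeas : P.Feasible xs) (hgrad : ContinuousAt P.grad xs)
    {x : ℕ → EuclideanSpace ℝ ι} (hx : Tendsto x atTop (𝓝 xs)) {lam : ℕ → I → ℝ}
    {mu : ℕ → J → ℝ} {u v : ℕ → L → ℝ} (hlam : ∀ k i, 0 ≤ lam k i)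
    (hinact : ∀ i ∉ P.activeIneq xs, Tendsto (fun k => lam k i) atTop (𝓝 0))
    (hu : ∀ᶠ k in atTop, ∀ l ∈ P.idxp0 xs, u k l = 0)
    (hv : ∀ᶠ k in atTop, ∀ l ∈ P.idx0p xs, v k l = 0)
    (hQM : ∀ᶠ k in atTop, ∀ l ∈ P.idx00 xs, (u k l, v k l) ∈ QM)
    (hlim : Tendsto (fun k => gradient P.f (x k) + P.gradComb (x k) (lam k) (mu k) (u k) (v k))
      atTop (𝓝 0)) :
    P.AMStationary xs := by
  classical
  set a : ℕ → ConstrIdx I J L → ℝ :=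
    fun k => coeff ((P.activeIneq xs).indicator (lam k)) (mu k) (u k) (v k)
  set d : ℕ → ConstrIdx I J L → ℝ := fun k => coeff ((P.activeIneq xs)ᶜ.indicator (lam k)) 0 0 0
  have hsplit : ∀ k, coeff (lam k) (mu k) (u k) (v k) = a k + d k := fun k => by
    funext c
    cases c with
    | ineq i => exact (Set.indicator_self_add_compl_apply (P.activeIneq xs) (lam k) i).symm
    | _ => simp [a, d, coeff]
  have hd : Tendsto d atTop (𝓝 0) := by
    refine tendsto_pi_nhds.2 fun c => ?_
    cases c with
    | ineq i =>
      by_cases hi : i ∈ P.activeIneq xs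
      · simp [d, coeff, hi]
      · simpa [d, coeff, hi] using hinact i hi
    | _ => simp [d, coeff]
  refine ⟨x, a, hx, ?_, ?_⟩
  · filter_upwards [hu, hv, hQM] with k huk hvk hQMk
    exact hfeas.coeff_mem_signCone (fun i => Set.indicator_nonneg (fun j _ => hlam k j) i)
      (fun i hi => Set.indicator_of_notMem hi _) huk hvk hQMk _
  · have herr := hlim.sub (tendsto_linearCombination (hgrad.tendsto.comp hx) hd)
    rw [map_zero, sub_zero] at herr
    refine herr.congr fun k => ?_
    rw [gradComb_eq_linearCombination, hsplit, map_add, Function.comp_apply]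
    abel

end Stationarity

end MPCC

section Gradient

variable {E F : Type*} [NormedAddCommGroup E] [InnerProductSpace ℝ E] [CompleteSpace E]
  [NormedAddCommGroup F] [InnerProductSpace ℝ F] [CompleteSpace F]

theorem continuous_gradient_of_contDiff {f : E → ℝ} (hf : ContDiff ℝ 1 f) :
    Continuous (gradient f) :=
  (InnerProductSpace.toDual ℝ E).symm.continuous.comp (hf.continuous_fderiv one_ne_zero)

theorem hasGradientAt_add {f g : E → ℝ} {f' g' x : E} (hf : HasGradientAt f f' x)
    (hg : HasGradientAt g g' x) : HasGradientAt (fun y => f y + g y) (f' + g') x := by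
  rw [hasGradientAt_iff_hasFDerivAt] at *
  rw [map_add]
  exact hf.add hg

theorem hasGradientAt_sub {f g : E → ℝ} {f' g' x : E} (hf : HasGradientAt f f' x)
    (hg : HasGradientAt g g' x) : HasGradientAt (fun y => f y - g y) (f' - g') x := by
  rw [hasGradientAt_iff_hasFDerivAt] at *
  rw [map_sub]
  exact hf.sub hg

theorem hasGradientAt_sum {α : Type*} {s : Finset α} {f : α → E → ℝ} {f' : α → E} {x : E}
    (hf : ∀ i ∈ s, HasGradientAt (f i) (f' i) x) :
    HasGradientAt (fun y => ∑ i ∈ s, f i y) (∑ i ∈ s, f' i) x := by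
  simp only [hasGradientAt_iff_hasFDerivAt, map_sum] at *
  exact HasFDerivAt.fun_sum hf

theorem hasGradientAt_comp_of_hasDerivAt {φ : ℝ → ℝ} {φ' : ℝ} {f : E → ℝ} {f' x : E}
    (hφ : HasDerivAt φ φ' (f x)) (hf : HasGradientAt f f' x) :
    HasGradientAt (fun y => φ (f y)) (φ' • f') x := by
  rw [hasGradientAt_iff_hasFDerivAt] at *
  rw [map_smulₛₗ, conj_trivial]
  exact hφ.comp_hasFDerivAt x hf

theorem hasGradientAt_comp_continuousLinearMap (A : E →L[ℝ] F) {f : F → ℝ} {f' : F} {x : E}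
    (hf : HasGradientAt f f' (A x)) :
    HasGradientAt (fun y => f (A y)) (ContinuousLinearMap.adjoint A f') x := by
  rw [hasGradientAt_iff_hasFDerivAt] at *
  refine (hf.comp x A.hasFDerivAt).congr_fderiv ?_
  ext y
  simp [ContinuousLinearMap.adjoint_inner_left]

end Gradient

section EuclideanSpace

variable {ι : Type*} [Fintype ι]

theorem gradient_euclideanSpace_apply [DecidableEq ι] (s : ι) (x : EuclideanSpace ℝ ι) :
    gradient (fun y : EuclideanSpace ℝ ι => y s) x = EuclideanSpace.single s 1 := by
  refine HasGradientAt.gradient (hasGradientAt_iff_hasFDerivAt.2 ?_)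
  refine (EuclideanSpace.proj s : EuclideanSpace ℝ ι →L[ℝ] ℝ).hasFDerivAt.congr_fderiv ?_
  ext y
  simp [EuclideanSpace.inner_single_left]

theorem norm_le_sqrt_card_mul_norm_ofLp (x : EuclideanSpace ℝ ι) :
    ‖x‖ ≤ √(Fintype.card ι) * ‖WithLp.ofLp x‖ := by
  simpa [Real.sqrt_eq_rpow, dist_eq_norm] using
    (PiLp.antilipschitzWith_ofLp 2 fun _ : ι => ℝ).le_mul_dist x 0

end EuclideanSpace

theorem hasDerivAt_quadratic_penalty {ρ : ℝ} (hρ : ρ ≠ 0) (c x : ℝ) :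
    HasDerivAt (fun y => ρ / 2 * (y + c / ρ) ^ 2) (c + ρ * x) x := by
  refine ((((hasDerivAt_id x).add_const (c / ρ)).pow 2).const_mul (ρ / 2)).congr_deriv ?_
  have hscale : c + ρ * x = ρ * (x + c / ρ) := by rw [mul_add, mul_div_cancel₀ c hρ, add_comm]
  rw [hscale, id]
  ring

theorem hasDerivAt_max_zero_sq (x : ℝ) :
    HasDerivAt (fun y : ℝ => max y 0 ^ 2) (2 * max x 0) x := by
  have hremainder : ∀ y : ℝ,
      |max y 0 ^ 2 - max x 0 ^ 2 - (y - x) * (2 * max x 0)| ≤ (y - x) ^ 2 := by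
    intro y
    rw [abs_le]
    rcases max_cases y 0 with ⟨hy, _⟩ | ⟨hy, _⟩ <;> rcases max_cases x 0 with ⟨hx, _⟩ | ⟨hx, _⟩ <;>
      rw [hy, hx] <;> constructor <;> nlinarith [sq_nonneg (y - x), sq_nonneg x, sq_nonneg y]
  rw [hasDerivAt_iff_isLittleO]
  refine Asymptotics.IsBigO.trans_isLittleO (g := fun y => (y - x) ^ 2)
    (Asymptotics.IsBigO.of_bound' (Eventually.of_forall fun y => ?_)) ?_
  · simpa using hremainder y
  · simpa using (Asymptotics.isLittleO_pow_sub_sub x one_lt_two)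

theorem hasDerivAt_positivePart_penalty {ρ : ℝ} (hρ : 0 < ρ) (c x : ℝ) :
    HasDerivAt (fun y => ρ / 2 * max (y + c / ρ) 0 ^ 2) (max (c + ρ * x) 0) x := by
  refine (((hasDerivAt_max_zero_sq (x + c / ρ)).comp_add_const x (c / ρ)).const_mul
    (ρ / 2)).congr_deriv ?_
  have hscale : c + ρ * x = ρ * (x + c / ρ) := by rw [mul_add, mul_div_cancel₀ c hρ.ne', add_comm]
  rw [hscale, ← mul_zero ρ, ← mul_max_of_nonneg _ _ hρ.le, mul_zero]
  ring

section Blocks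

variable {N n m : ℕ}

/-- The vector `w = (X, Y, Z)` with the given blocks. -/
def ofBlocks (x : EuclideanSpace ℝ (XIdx N n)) (y z : PairIdx N m → ℝ) :
    EuclideanSpace ℝ (WIdx N n m) :=
  WithLp.toLp 2 (Sum.elim x (Sum.elim y z))

@[simp] theorem ofBlocks_inl (x : EuclideanSpace ℝ (XIdx N n)) (y z : PairIdx N m → ℝ)
    (s : XIdx N n) : ofBlocks x y z (.inl s) = x s := rfl

@[simp] theorem ofBlocks_inr_inl (x : EuclideanSpace ℝ (XIdx N n)) (y z : PairIdx N m → ℝ)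
    (l : PairIdx N m) : ofBlocks x y z (.inr (.inl l)) = y l := rfl

@[simp] theorem ofBlocks_inr_inr (x : EuclideanSpace ℝ (XIdx N n)) (y z : PairIdx N m → ℝ)
    (l : PairIdx N m) : ofBlocks x y z (.inr (.inr l)) = z l := rfl

/-- The projection `xPart` as a continuous linear map. -/
noncomputable def xPartL :
    EuclideanSpace ℝ (WIdx N n m) →L[ℝ] EuclideanSpace ℝ (XIdx N n) :=
  LinearMap.toContinuousLinearMap
    { toFun := xPart, map_add' := fun _ _ => rfl, map_smul' := fun _ _ => rfl }

theorem adjoint_xPartL (x : EuclideanSpace ℝ (XIdx N n)) :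
    ContinuousLinearMap.adjoint (xPartL (m := m)) x = ofBlocks x 0 0 := by
  refine ext_inner_right ℝ fun a => ?_
  rw [ContinuousLinearMap.adjoint_inner_left, PiLp.inner_apply, PiLp.inner_apply,
    Fintype.sum_sum_type, Fintype.sum_sum_type]
  have hx : xPartL a = xPart a := rfl
  simp [hx, xPart]

theorem contDiff_stateAt (t : Fin (N + 1)) :
    ContDiff ℝ 1 (fun X : EuclideanSpace ℝ (XIdx N n) => stateAt X t) :=
  contDiff_euclidean.2 fun i => (EuclideanSpace.proj (𝕜 := ℝ) (t, i)).contDiff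

theorem contDiff_xPart :
    ContDiff ℝ 1 (xPart : EuclideanSpace ℝ (WIdx N n m) → EuclideanSpace ℝ (XIdx N n)) :=
  xPartL.contDiff

theorem contDiff_yPart (l : PairIdx N m) :
    ContDiff ℝ 1 (fun w : EuclideanSpace ℝ (WIdx N n m) => yPart w l) :=
  contDiff_euclidean.1 contDiff_id (Sum.inr (Sum.inl l))

theorem contDiff_zPart (l : PairIdx N m) :
    ContDiff ℝ 1 (fun w : EuclideanSpace ℝ (WIdx N n m) => zPart w l) :=
  contDiff_euclidean.1 contDiff_id (Sum.inr (Sum.inr l))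

theorem gradient_comp_xPart {F : EuclideanSpace ℝ (XIdx N n) → ℝ}
    (w : EuclideanSpace ℝ (WIdx N n m)) (hF : DifferentiableAt ℝ F (xPart w)) :
    gradient (fun w : EuclideanSpace ℝ (WIdx N n m) => F (xPart w)) w =
      ofBlocks (gradient F (xPart w)) 0 0 := by
  rw [← adjoint_xPartL]
  exact (hasGradientAt_comp_continuousLinearMap xPartL (x := w) hF.hasGradientAt).gradient

theorem gradient_yPart (l : PairIdx N m) (w : EuclideanSpace ℝ (WIdx N n m)) :
    gradient (fun w : EuclideanSpace ℝ (WIdx N n m) => yPart w l) w =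
      ofBlocks 0 (Pi.single l 1) 0 := by
  refine (gradient_euclideanSpace_apply (Sum.inr (Sum.inl l)) w).trans ?_
  ext s
  rcases s with s | s | s <;> simp [Pi.single_apply]

theorem gradient_zPart (l : PairIdx N m) (w : EuclideanSpace ℝ (WIdx N n m)) :
    gradient (fun w : EuclideanSpace ℝ (WIdx N n m) => zPart w l) w =
      ofBlocks 0 0 (Pi.single l 1) := by
  refine (gradient_euclideanSpace_apply (Sum.inr (Sum.inr l)) w).trans ?_
  ext s
  rcases s with s | s | s <;> simp [Pi.single_apply]

end Blocks

namespace TrajData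

variable {N n p q e d m : ℕ} {D : TrajData N n p q e d m}

theorem Smooth.contDiff_cost (hD : D.Smooth) : ContDiff ℝ 1 D.cost :=
  contDiff_const.mul (ContDiff.sum fun t _ => ((hD.1 t).comp (contDiff_stateAt t)).norm_sq ℝ)

theorem Smooth.contDiff_g (hD : D.Smooth) (i : Fin (N + 1) × Fin d) :
    ContDiff ℝ 1 (D.original.g i) :=
  contDiff_euclidean.1 ((hD.2.2.2.1 i.1).comp (contDiff_stateAt i.1)) i.2

theorem Smooth.contDiff_eqFun (hD : D.Smooth) (j : HIdx N q e) : ContDiff ℝ 1 (D.eqFun j) := by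
  rcases j with ⟨t, j⟩ | j
  · exact contDiff_euclidean.1
      ((hD.2.1 t).comp ((contDiff_stateAt t.castSucc).prodMk (contDiff_stateAt t.succ))) j
  · exact contDiff_euclidean.1 (hD.2.2.1.comp (contDiff_stateAt (Fin.last N))) j

theorem Smooth.contDiff_G (hD : D.Smooth) (l : PairIdx N m) : ContDiff ℝ 1 (D.original.G l) :=
  contDiff_euclidean.1 ((hD.2.2.2.2.1 l.1).comp (contDiff_stateAt l.1)) l.2

theorem Smooth.contDiff_H (hD : D.Smooth) (l : PairIdx N m) : ContDiff ℝ 1 (D.original.H l) :=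
  contDiff_euclidean.1 ((hD.2.2.2.2.2 l.1).comp (contDiff_stateAt l.1)) l.2

theorem Smooth.contDiff_vertical_f (hD : D.Smooth) : ContDiff ℝ 1 D.vertical.f :=
  hD.contDiff_cost.comp contDiff_xPart

theorem Smooth.contDiff_vertical_g (hD : D.Smooth) (i : Fin (N + 1) × Fin d) :
    ContDiff ℝ 1 (D.vertical.g i) :=
  (hD.contDiff_g i).comp contDiff_xPart

theorem Smooth.contDiff_hbar (hD : D.Smooth) (j : HBarIdx N q e m) : ContDiff ℝ 1 (D.hbar j) := by
  rcases j with j | l | l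
  · exact (hD.contDiff_eqFun j).comp contDiff_xPart
  · exact ((hD.contDiff_G l).comp contDiff_xPart).sub (contDiff_yPart l)
  · exact ((hD.contDiff_H l).comp contDiff_xPart).sub (contDiff_zPart l)

theorem Smooth.continuous_vertical_grad (hD : D.Smooth) : Continuous D.vertical.grad := by
  refine continuous_pi fun c => ?_
  cases c with
  | ineq i => exact continuous_gradient_of_contDiff (hD.contDiff_vertical_g i)
  | eq j => exact continuous_gradient_of_contDiff (hD.contDiff_hbar j)
  | compG l => exact continuous_gradient_of_contDiff (contDiff_yPart l)
  | compH l => exact continuous_gradient_of_contDiff (contDiff_zPart l)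

theorem Smooth.gradient_vertical_f (hD : D.Smooth) (w : EuclideanSpace ℝ (WIdx N n m)) :
    gradient D.vertical.f w = ofBlocks (gradient D.original.f (xPart w)) 0 0 :=
  gradient_comp_xPart w (hD.contDiff_cost.differentiable one_ne_zero _)

theorem Smooth.gradient_vertical_g (hD : D.Smooth) (i : Fin (N + 1) × Fin d)
    (w : EuclideanSpace ℝ (WIdx N n m)) :
    gradient (D.vertical.g i) w = ofBlocks (gradient (D.original.g i) (xPart w)) 0 0 :=
  gradient_comp_xPart w ((hD.contDiff_g i).differentiable one_ne_zero _)

theorem Smooth.gradient_hbar_eqFun (hD : D.Smooth) (j : HIdx N q e)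
    (w : EuclideanSpace ℝ (WIdx N n m)) :
    gradient (D.hbar (.inl j)) w = ofBlocks (gradient (D.original.h j) (xPart w)) 0 0 :=
  gradient_comp_xPart w ((hD.contDiff_eqFun j).differentiable one_ne_zero _)

theorem Smooth.gradient_hbar_compG (hD : D.Smooth) (l : PairIdx N m)
    (w : EuclideanSpace ℝ (WIdx N n m)) :
    gradient (D.hbar (.inr (.inl l))) w =
      ofBlocks (gradient (D.original.G l) (xPart w)) 0 0 - ofBlocks 0 (Pi.single l 1) 0 := by
  have hG := (hD.contDiff_G l).differentiable one_ne_zero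
  rw [← gradient_comp_xPart w (hG _), ← gradient_yPart l w]
  exact (hasGradientAt_sub (((hD.contDiff_G l).comp contDiff_xPart).differentiable one_ne_zero
    w).hasGradientAt ((contDiff_yPart l).differentiable one_ne_zero w).hasGradientAt).gradient

theorem Smooth.gradient_hbar_compH (hD : D.Smooth) (l : PairIdx N m)
    (w : EuclideanSpace ℝ (WIdx N n m)) :
    gradient (D.hbar (.inr (.inr l))) w =
      ofBlocks (gradient (D.original.H l) (xPart w)) 0 0 - ofBlocks 0 0 (Pi.single l 1) := by
  have hH := (hD.contDiff_H l).differentiable one_ne_zero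
  rw [← gradient_comp_xPart w (hH _), ← gradient_zPart l w]
  exact (hasGradientAt_sub (((hD.contDiff_H l).comp contDiff_xPart).differentiable one_ne_zero
    w).hasGradientAt ((contDiff_zPart l).differentiable one_ne_zero w).hasGradientAt).gradient

theorem Smooth.gradient_add_gradComb_vertical (hD : D.Smooth) (lam : Fin (N + 1) × Fin d → ℝ)
    (κ : HBarIdx N q e m → ℝ) (u v : PairIdx N m → ℝ) (w : EuclideanSpace ℝ (WIdx N n m)) :
    gradient D.vertical.f w + D.vertical.gradComb w lam κ u v =
      ofBlocks
        (gradient D.original.f (xPart w) + D.original.gradComb (xPart w) lam (fun j => κ (.inl j))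
          (fun l => -κ (.inr (.inl l))) (fun l => -κ (.inr (.inr l))))
        (fun l => -κ (.inr (.inl l)) - u l) (fun l => -κ (.inr (.inr l)) - v l) := by
  have hh : ∀ j, gradient (D.vertical.h j) w = gradient (D.hbar j) w := fun j => rfl
  have hy : ∀ l, gradient (D.vertical.G l) w = _ := fun l => gradient_yPart l w
  have hz : ∀ l, gradient (D.vertical.H l) w = _ := fun l => gradient_zPart l w
  simp only [MPCC.gradComb, Fintype.sum_sum_type, hh, hy, hz, hD.gradient_vertical_f,
    hD.gradient_vertical_g, hD.gradient_hbar_eqFun, hD.gradient_hbar_compG, hD.gradient_hbar_compH]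
  ext s
  rcases s with s | l | l
  · simp
    ring
  · simp [Pi.single_apply]
  · simp [Pi.single_apply]

theorem Smooth.mStationary_original (hD : D.Smooth) {w : EuclideanSpace ℝ (WIdx N n m)}
    (h : D.vertical.MStationary w) : D.original.MStationary (xPart w) := by
  obtain ⟨⟨hg, hh, hcompl⟩, lam, κ, u, v, hsum, hlam, hu, hv, hQM⟩ := h
  have hG : ∀ l, D.original.G l (xPart w) = yPart w l :=
    fun l => sub_eq_zero.1 (hh (.inr (.inl l)))
  have hH : ∀ l, D.original.H l (xPart w) = zPart w l :=
    fun l => sub_eq_zero.1 (hh (.inr (.inr l)))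
  rw [hD.gradient_add_gradComb_vertical] at hsum
  have hblock := fun s => congrArg (fun a : EuclideanSpace ℝ (WIdx N n m) => a s) hsum
  have hκu : ∀ l, -κ (.inr (.inl l)) = u l := fun l => sub_eq_zero.1 (hblock (.inr (.inl l)))
  have hκv : ∀ l, -κ (.inr (.inr l)) = v l := fun l => sub_eq_zero.1 (hblock (.inr (.inr l)))
  simp only [hκu, hκv] at hblock
  refine ⟨⟨hg, fun j => hh (.inl j), fun l => ?_⟩, lam, fun j => κ (.inl j), u, v,
    PiLp.ext fun s => hblock (.inl s), hlam, fun l hl => hu l ?_, fun l hl => hv l ?_,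
    fun l hl => hQM l ?_⟩
  · rw [hG, hH]
    exact hcompl l
  all_goals
    obtain ⟨hGl, hHl⟩ := hl
    rw [hG] at hGl
    rw [hH] at hHl
    exact ⟨hGl, hHl⟩

theorem Smooth.gradient_aula (hD : D.Smooth) {ρh ρg : ℝ} (hρh : ρh ≠ 0) (hρg : 0 < ρg)
    (κ : HBarIdx N q e m → ℝ) (μ : Fin (N + 1) × Fin d → ℝ)
    (w : EuclideanSpace ℝ (WIdx N n m)) :
    gradient (D.aula ρh ρg κ μ) w = gradient D.vertical.f w +
      ∑ j, (κ j + ρh * D.hbar j w) • gradient (D.hbar j) w +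
      ∑ i, max (μ i + ρg * D.vertical.g i w) 0 • gradient (D.vertical.g i) w := by
  have hgradient : ∀ {f : EuclideanSpace ℝ (WIdx N n m) → ℝ}, ContDiff ℝ 1 f →
      HasGradientAt f (gradient f w) w :=
    fun hf => (hf.differentiable one_ne_zero w).hasGradientAt
  have haula : D.aula ρh ρg κ μ = fun w => D.vertical.f w +
      ∑ j, ρh / 2 * (D.hbar j w + κ j / ρh) ^ 2 +
      ∑ i, ρg / 2 * max (D.vertical.g i w + μ i / ρg) 0 ^ 2 := by
    funext w
    rw [← Finset.mul_sum, ← Finset.mul_sum]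
    rfl
  rw [haula]
  refine (hasGradientAt_add (hasGradientAt_add (hgradient hD.contDiff_vertical_f)
    (hasGradientAt_sum fun j _ => ?_)) (hasGradientAt_sum fun i _ => ?_)).gradient
  · exact hasGradientAt_comp_of_hasDerivAt (f := D.hbar j)
      (hasDerivAt_quadratic_penalty hρh (κ j) _) (hgradient (hD.contDiff_hbar j))
  · exact hasGradientAt_comp_of_hasDerivAt (f := D.vertical.g i)
      (hasDerivAt_positivePart_penalty hρg (μ i) _) (hgradient (hD.contDiff_vertical_g i))

end TrajData

/-- `(α, β)` is a regular normal to the planar complementarity set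
`{(y, z) | 0 ≤ y ⊥ z ≥ 0}` at the point `(y, z)` of that set. -/
def RegularComplNormal (y z α β : ℝ) : Prop :=
  (0 < y ∧ z = 0 ∧ α = 0) ∨ (y = 0 ∧ 0 < z ∧ β = 0) ∨ (y = 0 ∧ z = 0 ∧ α ≤ 0 ∧ β ≤ 0)

namespace RegularComplNormal

variable {y z α β : ℝ}

theorem mem_compl (h : RegularComplNormal y z α β) : 0 ≤ y ∧ 0 ≤ z ∧ y * z = 0 := by
  rcases h with ⟨hy, rfl, -⟩ | ⟨rfl, hz, -⟩ | ⟨rfl, rfl, -⟩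
  · exact ⟨hy.le, le_rfl, mul_zero y⟩
  · exact ⟨le_rfl, hz.le, zero_mul z⟩
  · exact ⟨le_rfl, le_rfl, zero_mul 0⟩

theorem mul_sub_add_mul_sub_nonpos (h : RegularComplNormal y z α β) {y' z' : ℝ} (hy' : 0 ≤ y')
    (hz' : 0 ≤ z') (hyz' : y' * z' = 0) (hypos : 0 < y → 0 < y') (hzpos : 0 < z → 0 < z') :
    α * (y' - y) + β * (z' - z) ≤ 0 := by
  rcases h with ⟨hy, rfl, rfl⟩ | ⟨rfl, hz, rfl⟩ | ⟨rfl, rfl, hα, hβ⟩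
  · simp [(mul_eq_zero.1 hyz').resolve_left (hypos hy).ne']
  · simp [(mul_eq_zero.1 hyz').resolve_right (hzpos hz).ne']
  · rw [sub_zero, sub_zero]
    exact add_nonpos (mul_nonpos_of_nonpos_of_nonneg hα hy')
      (mul_nonpos_of_nonpos_of_nonneg hβ hz')

theorem exists_direction (hy : 0 ≤ y) (hz : 0 ≤ z) (hyz : y * z = 0) (hα : 0 < y → α = 0)
    (hβ : 0 < z → β = 0) (hQM : (-α, -β) ∈ QM) :
    ∃ dy dz : ℝ, ∀ t > 0, RegularComplNormal (y + t * dy) (z + t * dz) α β := by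
  rcases hy.eq_or_lt with rfl | hy
  · rcases hz.eq_or_lt with rfl | hz
    · rcases hQM with ⟨hα', hβ'⟩ | hαβ
      · exact ⟨0, 0, fun t _ => Or.inr (Or.inr
          ⟨by simp, by simp, (neg_pos.1 hα').le, (neg_pos.1 hβ').le⟩)⟩
      · rcases mul_eq_zero.1 hαβ with hα' | hβ'
        · exact ⟨1, 0, fun t ht => Or.inl ⟨by simpa using ht, by simp, neg_eq_zero.1 hα'⟩⟩
        · exact ⟨0, 1, fun t ht => Or.inr (Or.inl
            ⟨by simp, by simpa using ht, neg_eq_zero.1 hβ'⟩)⟩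
    · exact ⟨0, 0, fun t _ => Or.inr (Or.inl ⟨by simp, by simpa using hz, hβ hz⟩)⟩
  · have hz0 : z = 0 := (mul_eq_zero.1 hyz).resolve_left hy.ne'
    exact ⟨0, 0, fun t _ => Or.inl ⟨by simpa using hy, by simpa using hz0, hα hy⟩⟩

end RegularComplNormal

section ComplementaritySet

variable {S : Type} [Fintype S] {a ν : EuclideanSpace ℝ (S ⊕ S)}

theorem mem_regularNormalCone_complSet
    (h : ∀ s, RegularComplNormal (a (.inl s)) (a (.inr s)) (ν (.inl s)) (ν (.inr s))) :
    ν ∈ regularNormalCone (complSet S) a := by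
  intro c hc
  have hpos : ∀ᶠ b in 𝓝 a, ∀ i, 0 < a i → 0 < b i := by
    refine eventually_all.2 fun i => ?_
    by_cases hi : 0 < a i
    · have hcoord : ContinuousAt (fun b : EuclideanSpace ℝ (S ⊕ S) => b i) a :=
        (EuclideanSpace.proj (𝕜 := ℝ) i).continuous.continuousAt
      filter_upwards [hcoord.eventually (lt_mem_nhds hi)] with b hb _ using hb
    · exact Eventually.of_forall fun b hi' => absurd hi' hi
  filter_upwards [nhdsWithin_le_nhds hpos, self_mem_nhdsWithin] with b hb hbS
  refine le_trans ?_ (mul_nonneg hc.le (norm_nonneg (b - a)))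
  rw [PiLp.inner_apply, Fintype.sum_sum_type, ← Finset.sum_add_distrib]
  refine Finset.sum_nonpos fun s _ => ?_
  obtain ⟨hy, hz, hyz⟩ := hbS s
  have hpair := (h s).mul_sub_add_mul_sub_nonpos hy hz hyz (hb _) (hb _)
  simp only [PiLp.sub_apply, RCLike.inner_apply, conj_trivial]
  linarith

/-- Perturbing the biactive pairs along a coordinate axis reaches points at which `ν` is a regular
normal. -/
theorem mem_limitingNormalCone_complSet (ha : a ∈ complSet S)
    (h : ∀ s, (0 < a (.inl s) → ν (.inl s) = 0) ∧ (0 < a (.inr s) → ν (.inr s) = 0) ∧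
      (-ν (.inl s), -ν (.inr s)) ∈ QM) :
    ν ∈ limitingNormalCone (complSet S) a := by
  choose dy dz hdir using fun s => RegularComplNormal.exists_direction (ha s).1 (ha s).2.1
    (ha s).2.2 (h s).1 (h s).2.1 (h s).2.2
  set b : EuclideanSpace ℝ (S ⊕ S) := WithLp.toLp 2 (Sum.elim dy dz)
  have ht : ∀ k : ℕ, (0 : ℝ) < 1 / ((k : ℝ) + 1) := fun k => Nat.one_div_pos_of_nat
  refine ⟨fun k => a + (1 / ((k : ℝ) + 1)) • b, fun _ => ν,
    fun k s => (hdir s _ (ht k)).mem_compl,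
    fun k => mem_regularNormalCone_complSet fun s => hdir s _ (ht k), ?_, tendsto_const_nhds⟩
  simpa using tendsto_const_nhds.add
    ((tendsto_one_div_add_atTop_nhds_zero_nat (𝕜 := ℝ)).smul_const b)

end ComplementaritySet

section Residual

variable {N n m : ℕ} {Φ : EuclideanSpace ℝ (WIdx N n m) → ℝ} {w : EuclideanSpace ℝ (WIdx N n m)}
  {u v : PairIdx N m → ℝ}

theorem zero_mem_multM (w : EuclideanSpace ℝ (WIdx N n m)) : (0, 0) ∈ multM w :=
  fun l => by simp [QM]

theorem eq_zero_and_mem_QM_of_mem_multM (hw : yzPart w ∈ complSet (PairIdx N m))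
    (h : (u, v) ∈ multM w) (l : PairIdx N m) :
    (0 < yPart w l → u l = 0) ∧ (0 < zPart w l → v l = 0) ∧ (u l, v l) ∈ QM := by
  obtain ⟨hu, hv, hQM⟩ := h l
  obtain ⟨hy, hz, hyz⟩ : 0 ≤ yPart w l ∧ 0 ≤ zPart w l ∧ yPart w l * zPart w l = 0 := hw l
  have hu' : 0 < yPart w l → u l = 0 :=
    fun h => hu ⟨h, (mul_eq_zero.1 hyz).resolve_left h.ne'⟩
  have hv' : 0 < zPart w l → v l = 0 :=
    fun h => hv ⟨(mul_eq_zero.1 hyz).resolve_right h.ne', h⟩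
  refine ⟨hu', hv', ?_⟩
  rcases hy.eq_or_lt with hy | hy
  · rcases hz.eq_or_lt with hz | hz
    · exact hQM ⟨hy.symm, hz.symm⟩
    · exact Or.inr (mul_eq_zero_of_right _ (hv' hz))
  · exact Or.inr (mul_eq_zero_of_left (hu' hy) _)

theorem eventually_eq_zero_of_mem_multM {α : Type*} {F : Filter α}
    {w : α → EuclideanSpace ℝ (WIdx N n m)} {ws : EuclideanSpace ℝ (WIdx N n m)}
    {u v : α → PairIdx N m → ℝ} (hw : Tendsto w F (𝓝 ws))
    (hcompl : ∀ k, yzPart (w k) ∈ complSet (PairIdx N m)) (h : ∀ k, (u k, v k) ∈ multM (w k)) :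
    ∀ᶠ k in F, ∀ l, (0 < yPart ws l → u k l = 0) ∧ (0 < zPart ws l → v k l = 0) := by
  refine eventually_all.2 fun l => ?_
  have hy : ∀ᶠ k in F, 0 < yPart ws l → 0 < yPart (w k) l :=
    eventually_imp_distrib_left.2
      (((contDiff_yPart l).continuous.tendsto ws).comp hw).eventually_const_lt
  have hz : ∀ᶠ k in F, 0 < zPart ws l → 0 < zPart (w k) l :=
    eventually_imp_distrib_left.2
      (((contDiff_zPart l).continuous.tendsto ws).comp hw).eventually_const_lt
  filter_upwards [hy, hz] with k hyk hzk
  obtain ⟨hu, hv, -⟩ := eq_zero_and_mem_QM_of_mem_multM (hcompl k) (h k) l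
  exact ⟨hu ∘ hyk, hv ∘ hzk⟩

theorem norm_gradient_sub_ofBlocks_le (Φ : EuclideanSpace ℝ (WIdx N n m) → ℝ)
    (w : EuclideanSpace ℝ (WIdx N n m)) (u v : PairIdx N m → ℝ) :
    ‖gradient Φ w - ofBlocks 0 u v‖ ≤ √(Fintype.card (WIdx N n m)) * rInAt Φ w u v := by
  refine (norm_le_sqrt_card_mul_norm_ofLp _).trans
    (mul_le_mul_of_nonneg_left ?_ (Real.sqrt_nonneg _))
  obtain ⟨hx, hyz⟩ := max_le_iff.1 (le_refl (rInAt Φ w u v))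
  obtain ⟨hy, hz⟩ := max_le_iff.1 hyz
  refine (pi_norm_le_iff_of_nonneg ((norm_nonneg _).trans hx)).2 fun s => ?_
  rcases s with s | l | l
  · simpa using (norm_le_pi_norm _ s).trans hx
  · exact (norm_le_pi_norm (yPart (gradient Φ w) - u) l).trans hy
  · exact (norm_le_pi_norm (zPart (gradient Φ w) - v) l).trans (max_le_iff.1 hz).1

theorem gradient_sub_ofBlocks_mem_stationaritySet (hw : yzPart w ∈ complSet (PairIdx N m))
    (h : (u, v) ∈ multM w) : gradient Φ w - ofBlocks 0 u v ∈ stationaritySet Φ w := by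
  refine ⟨-ofBlocks 0 u v, ?_, mem_limitingNormalCone_complSet hw fun l => ?_, sub_eq_add_neg _ _⟩
  · ext s
    simp [xPart]
  · simpa [yzPart, yPart, zPart] using eq_zero_and_mem_QM_of_mem_multM hw h l

theorem infDist_stationaritySet_le (hw : yzPart w ∈ complSet (PairIdx N m)) :
    Metric.infDist 0 (stationaritySet Φ w) ≤ √(Fintype.card (WIdx N n m)) * rIn Φ w := by
  have : Nonempty (multM w) := ⟨⟨_, zero_mem_multM w⟩⟩
  rw [rIn, Real.mul_iInf_of_nonneg (Real.sqrt_nonneg _)]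
  refine le_ciInf fun ⟨⟨u, v⟩, huv⟩ => ?_
  calc Metric.infDist 0 (stationaritySet Φ w)
      ≤ dist 0 (gradient Φ w - ofBlocks 0 u v) :=
        Metric.infDist_le_dist_of_mem (gradient_sub_ofBlocks_mem_stationaritySet hw huv)
    _ = ‖gradient Φ w - ofBlocks 0 u v‖ := dist_zero_left _
    _ ≤ √(Fintype.card (WIdx N n m)) * rInAt Φ w u v := norm_gradient_sub_ofBlocks_le Φ w u v

theorem exists_multM_norm_le_of_rIn_lt {c : ℝ} (h : rIn Φ w < c) :
    ∃ u v : PairIdx N m → ℝ, (u, v) ∈ multM w ∧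
      ‖gradient Φ w - ofBlocks 0 u v‖ ≤ √(Fintype.card (WIdx N n m)) * c := by
  have : Nonempty (multM w) := ⟨⟨_, zero_mem_multM w⟩⟩
  obtain ⟨⟨⟨u, v⟩, huv⟩, hlt⟩ := exists_lt_of_ciInf_lt h
  exact ⟨u, v, huv, (norm_gradient_sub_ofBlocks_le Φ w u v).trans
    (mul_le_mul_of_nonneg_left hlt.le (Real.sqrt_nonneg _))⟩

end Residual

theorem exists_strictMono_tendsto_succ {X : Type*} [TopologicalSpace X]
    [FirstCountableTopology X] {u : ℕ → X} {x : X} (hx : MapClusterPt x atTop u) :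
    ∃ φ : ℕ → ℕ, StrictMono φ ∧ Tendsto (fun j => u (φ j + 1)) atTop (𝓝 x) := by
  rw [← map_add_atTop_eq_nat 1] at hx
  exact (mapClusterPt_comp.2 hx).tendsto_subseq

theorem tendsto_zero_of_tendsto_min_zero {ι : Type*} {F : Filter ι} {a b : ι → ℝ} {L : ℝ}
    (hL : 0 < L) (hb : Tendsto b F (𝓝 L)) (hmin : Tendsto (fun j => min (a j) (b j)) F (𝓝 0)) :
    Tendsto a F (𝓝 0) := by
  refine hmin.congr' ?_
  filter_upwards [hmin.eventually_lt hb hL] with j hj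
  exact min_eq_left_of_lt ((min_lt_iff.1 hj).resolve_right (lt_irrefl _))

section OuterLoop

variable {N n p q e d m : ℕ} {D : TrajData N n p q e d m}

theorem sum_smul_gradient_slack (u v : PairIdx N m → ℝ) (w : EuclideanSpace ℝ (WIdx N n m)) :
    ∑ l, u l • gradient (D.vertical.G l) w + ∑ l, v l • gradient (D.vertical.H l) w =
      ofBlocks 0 u v := by
  have hy : ∀ l, gradient (D.vertical.G l) w = _ := fun l => gradient_yPart l w
  have hz : ∀ l, gradient (D.vertical.H l) w = _ := fun l => gradient_zPart l w
  simp only [hy, hz]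
  ext s
  rcases s with s | l | l <;> simp [Pi.single_apply]

theorem TrajData.Smooth.gradient_aula_sub_ofBlocks (hD : D.Smooth) {ρh ρg : ℝ} (hρh : ρh ≠ 0)
    (hρg : 0 < ρg) (κ : HBarIdx N q e m → ℝ) (μ : Fin (N + 1) × Fin d → ℝ)
    (u v : PairIdx N m → ℝ) (w : EuclideanSpace ℝ (WIdx N n m)) :
    gradient (D.aula ρh ρg κ μ) w - ofBlocks 0 u v =
      gradient D.vertical.f w + D.vertical.gradComb w
        (fun i => max (μ i + ρg * D.vertical.g i w) 0) (fun j => κ j + ρh * D.hbar j w) u v := by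
  have hh : ∀ j, gradient (D.vertical.h j) w = gradient (D.hbar j) w := fun j => rfl
  rw [hD.gradient_aula hρh hρg, ← sum_smul_gradient_slack (D := D) u v w, MPCC.gradComb]
  simp only [hh]
  abel

namespace IsSafeguardedAuLa

variable {Sκ : ℕ → (HBarIdx N q e m → ℝ) → (HBarIdx N q e m → ℝ)}
  {Sμ : ℕ → (Fin (N + 1) × Fin d → ℝ) → (Fin (N + 1) × Fin d → ℝ)}
  {γ η : ℝ} {w : ℕ → EuclideanSpace ℝ (WIdx N n m)}
  {κ κbar : ℕ → HBarIdx N q e m → ℝ} {μ μbar : ℕ → Fin (N + 1) × Fin d → ℝ} {ρh ρg : ℕ → ℝ}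

theorem penalties_pos (hrun : IsSafeguardedAuLa D Sκ Sμ γ η w κ κbar μ μbar ρh ρg) (hγ : 1 < γ)
    (k : ℕ) : 0 < ρh k ∧ 0 < ρg k := by
  have hγ0 : 0 < γ := one_pos.trans hγ
  induction k with
  | zero => exact hrun.penalty_pos
  | succ k ih =>
    by_cases hk : k = 0 ∨
        outerViolation D (w (k + 1)) (μ (k + 1)) ≤ η * outerViolation D (w k) (μ k)
    · obtain ⟨hρh, hρg⟩ := hrun.penalty_keep k hk
      rwa [hρh, hρg]
    · obtain ⟨hρh, hρg⟩ := hrun.penalty_increase k hk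
      rw [hρh, hρg]
      exact ⟨mul_pos hγ0 ih.1, mul_pos hγ0 ih.2⟩

theorem monotone_penalty (hrun : IsSafeguardedAuLa D Sκ Sμ γ η w κ κbar μ μbar ρh ρg)
    (hγ : 1 < γ) : Monotone ρg := by
  refine monotone_nat_of_le_succ fun k => ?_
  by_cases hk : k = 0 ∨
      outerViolation D (w (k + 1)) (μ (k + 1)) ≤ η * outerViolation D (w k) (μ k)
  · exact (hrun.penalty_keep k hk).2.ge
  · rw [(hrun.penalty_increase k hk).2]
    exact le_mul_of_one_le_left (hrun.penalties_pos hγ k).2.le hγ.le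

theorem tendsto_penalty_atTop_or_tendsto_outerViolation_zero
    (hrun : IsSafeguardedAuLa D Sκ Sμ γ η w κ κbar μ μbar ρh ρg) (hγ : 1 < γ) (hη1 : η < 1) :
    Tendsto ρg atTop atTop ∨ Tendsto (fun k => outerViolation D (w k) (μ k)) atTop (𝓝 0) := by
  refine (tendsto_atTop_of_monotone (hrun.monotone_penalty hγ)).imp_right ?_
  rintro ⟨L, hL⟩
  have hL0 : 0 < L :=
    (hrun.penalties_pos hγ 0).2.trans_le ((hrun.monotone_penalty hγ).ge_of_tendsto hL 0)
  have hincrease : ∀ᶠ k in atTop, ρg (k + 1) - γ * ρg k ≠ 0 :=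
    ((hL.comp (tendsto_add_atTop_nat 1)).sub (hL.const_mul γ)).eventually_ne (by nlinarith)
  have hnonneg : ∀ k, 0 ≤ outerViolation D (w k) (μ k) := fun k =>
    (norm_nonneg _).trans (le_max_left _ _)
  have hdecrease : ∀ᶠ k in atTop, ‖outerViolation D (w (k + 1)) (μ (k + 1))‖ ≤
      η * ‖outerViolation D (w k) (μ k)‖ := by
    filter_upwards [hincrease, eventually_ne_atTop 0] with k hk hk0
    rw [Real.norm_of_nonneg (hnonneg _), Real.norm_of_nonneg (hnonneg _)]
    by_contra hcon
    exact hk (sub_eq_zero.2 (hrun.penalty_increase k (not_or.2 ⟨hk0, hcon⟩)).2)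
  exact (summable_of_ratio_norm_eventually_le hη1 hdecrease).tendsto_atTop_zero

/-- If the penalty diverges the update truncates the multiplier to `0`; otherwise the
complementarity measure `min (μ, -g)` tends to `0` while `-g` stays positive. -/
theorem tendsto_multiplier_zero_of_inactive
    (hrun : IsSafeguardedAuLa D Sκ Sμ γ η w κ κbar μ μbar ρh ρg) (hγ : 1 < γ) (hη1 : η < 1)
    {i : Fin (N + 1) × Fin d} {B : ℝ} (hB : ∀ k, μbar k i ≤ B) {φ : ℕ → ℕ}
    (hφ : Tendsto φ atTop atTop) {L : ℝ} (hL : L < 0)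
    (hlim : Tendsto (fun j => D.vertical.g i (w (φ j + 1))) atTop (𝓝 L)) :
    Tendsto (fun j => μ (φ j + 1) i) atTop (𝓝 0) := by
  rcases hrun.tendsto_penalty_atTop_or_tendsto_outerViolation_zero hγ hη1 with hρ | hviol
  · have hbot : Tendsto (fun j => ρg (φ j) * D.vertical.g i (w (φ j + 1))) atTop atBot :=
      (hρ.comp hφ).atTop_mul_neg hL hlim
    refine tendsto_const_nhds.congr' ?_
    filter_upwards [hbot.eventually_le_atBot (-B)] with j hj
    rw [hrun.update_mu, max_eq_right (by linarith [hB (φ j)])]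
  · refine tendsto_zero_of_tendsto_min_zero (neg_pos.2 hL) hlim.neg
      (squeeze_zero_norm (fun j => ?_) (hviol.comp ((tendsto_add_atTop_nat 1).comp hφ)))
    exact (norm_le_pi_norm (fun i => min (μ (φ j + 1) i) (-D.vertical.g i (w (φ j + 1)))) i).trans
      (le_max_left _ _)

theorem exists_multM_norm_le (hD : D.Smooth)
    (hrun : IsSafeguardedAuLa D Sκ Sμ γ η w κ κbar μ μbar ρh ρg) (hγ : 1 < γ) {k : ℕ} {c : ℝ}
    (hc : rIn (D.aula (ρh k) (ρg k) (κbar k) (μbar k)) (w (k + 1)) < c) :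
    ∃ u v : PairIdx N m → ℝ, (u, v) ∈ multM (w (k + 1)) ∧
      ‖gradient D.vertical.f (w (k + 1)) +
        D.vertical.gradComb (w (k + 1)) (μ (k + 1)) (κ (k + 1)) u v‖ ≤
          √(Fintype.card (WIdx N n m)) * c := by
  obtain ⟨u, v, huv, hle⟩ := exists_multM_norm_le_of_rIn_lt hc
  obtain ⟨hρh, hρg⟩ := hrun.penalties_pos hγ k
  refine ⟨u, v, huv, ?_⟩
  rw [hD.gradient_aula_sub_ofBlocks hρh.ne' hρg] at hle
  simpa only [← hrun.update_kappa, ← hrun.update_mu] using hle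

theorem amStationary (hD : D.Smooth)
    (hrun : IsSafeguardedAuLa D Sκ Sμ γ η w κ κbar μ μbar ρh ρg) (hγ : 1 < γ) (hη1 : η < 1)
    {B : ℝ} (hB : ∀ k i, μbar k i ≤ B) {ε : ℕ → ℝ} (hε : Tendsto ε atTop (𝓝 0))
    (hin : ∀ k, rIn (D.aula (ρh k) (ρg k) (κbar k) (μbar k)) (w (k + 1)) ≤ ε k)
    {ws : EuclideanSpace ℝ (WIdx N n m)} (hws : MapClusterPt ws atTop w)
    (hfeas : D.vertical.Feasible ws) : D.vertical.AMStationary ws := by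
  have hin' : ∀ k, rIn (D.aula (ρh k) (ρg k) (κbar k) (μbar k)) (w (k + 1)) <
      ε k + 1 / ((k : ℝ) + 1) := fun k =>
    (hin k).trans_lt (lt_add_of_pos_right _ (by positivity))
  choose u v huv hle using fun k => hrun.exists_multM_norm_le hD hγ (hin' k)
  obtain ⟨φ, hφ, hw⟩ := exists_strictMono_tendsto_succ hws
  have hvanish := eventually_eq_zero_of_mem_multM hw
    (fun j => hrun.hard_constraint (φ j)) (fun j => huv (φ j))
  refine MPCC.amStationary_of_tendsto hfeas hD.continuous_vertical_grad.continuousAt hw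
    (lam := fun j => μ (φ j + 1)) (mu := fun j => κ (φ j + 1))
    (u := fun j => u (φ j)) (v := fun j => v (φ j)) (fun j i => ?_) (fun i hi => ?_)
    (hvanish.mono fun j hj l hl => (hj l).1 hl.1) (hvanish.mono fun j hj l hl => (hj l).2 hl.2)
    (.of_forall fun j l _ => ?_) ?_
  · rw [hrun.update_mu]
    exact le_max_right _ _
  · exact hrun.tendsto_multiplier_zero_of_inactive hγ hη1 (hB · i) hφ.tendsto_atTop
      ((hfeas.1 i).lt_of_ne hi)
      (((hD.contDiff_vertical_g i).continuous.tendsto ws).comp hw)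
  · exact (eq_zero_and_mem_QM_of_mem_multM (hrun.hard_constraint (φ j)) (huv (φ j)) l).2.2
  · refine squeeze_zero_norm (fun j => hle (φ j)) ?_
    have hbound : Tendsto (fun k => √(Fintype.card (WIdx N n m)) * (ε k + 1 / ((k : ℝ) + 1)))
        atTop (𝓝 0) := by
      simpa using (hε.add (tendsto_one_div_add_atTop_nhds_zero_nat (𝕜 := ℝ))).const_mul _
    exact hbound.comp hφ.tendsto_atTop

end IsSafeguardedAuLa

end OuterLoop

theorem mainTheorem2_general {N n p q e d m : ℕ} (D : TrajData N n p q e d m) (hD : D.Smooth)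
    (Sκ : ℕ → (HBarIdx N q e m → ℝ) → (HBarIdx N q e m → ℝ))
    (Sμ : ℕ → (Fin (N + 1) × Fin d → ℝ) → (Fin (N + 1) × Fin d → ℝ))
    (γ η : ℝ) (hγ : 1 < γ) (hη1 : η < 1)
    (w : ℕ → EuclideanSpace ℝ (WIdx N n m))
    (κ κbar : ℕ → HBarIdx N q e m → ℝ) (μ μbar : ℕ → Fin (N + 1) × Fin d → ℝ)
    (ρh ρg : ℕ → ℝ)
    (hrun : IsSafeguardedAuLa D Sκ Sμ γ η w κ κbar μ μbar ρh ρg)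
    (hbdd : ∃ B : ℝ, ∀ k i, μbar k i ≤ B)
    (ε : ℕ → ℝ) (hεlim : Tendsto ε atTop (𝓝 0))
    (hin : ∀ k, rIn (D.aula (ρh k) (ρg k) (κbar k) (μbar k)) (w (k + 1)) ≤ ε k) :
    (∀ k, Metric.infDist 0
        (stationaritySet (D.aula (ρh k) (ρg k) (κbar k) (μbar k)) (w (k + 1)))
          ≤ √(Fintype.card (WIdx N n m)) * ε k) ∧
    ∀ wstar : EuclideanSpace ℝ (WIdx N n m),
      MapClusterPt wstar atTop w → D.vertical.Feasible wstar → D.vertical.RCPLD wstar →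
        D.vertical.MStationary wstar ∧ D.original.MStationary (xPart wstar) := by
  obtain ⟨B, hB⟩ := hbdd
  refine ⟨fun k => (infDist_stationaritySet_le (hrun.hard_constraint k)).trans
    (mul_le_mul_of_nonneg_left (hin k) (Real.sqrt_nonneg _)), fun wstar hcluster hfeas hR => ?_⟩
  have hvertical : D.vertical.MStationary wstar :=
    (hrun.amStationary hD hγ hη1 hB hεlim hin hcluster hfeas).mStationary hfeas hR
      (continuous_gradient_of_contDiff hD.contDiff_vertical_f).continuousAt
      hD.continuous_vertical_grad.continuousAt
  exact ⟨hvertical, hD.mStationary_original hvertical⟩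

theorem mainTheorem2 {N n p q e d m : ℕ} (D : TrajData N n p q e d m) (hD : D.Smooth)
    (Sκ : ℕ → (HBarIdx N q e m → ℝ) → (HBarIdx N q e m → ℝ))
    (Sμ : ℕ → (Fin (N + 1) × Fin d → ℝ) → (Fin (N + 1) × Fin d → ℝ))
    (γ η : ℝ) (hγ : 1 < γ) (hη0 : 0 ≤ η) (hη1 : η < 1)
    (w : ℕ → EuclideanSpace ℝ (WIdx N n m))
    (κ κbar : ℕ → HBarIdx N q e m → ℝ) (μ μbar : ℕ → Fin (N + 1) × Fin d → ℝ)
    (ρh ρg : ℕ → ℝ)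
    (hrun : IsSafeguardedAuLa D Sκ Sμ γ η w κ κbar μ μbar ρh ρg)
    (hbdd : ∃ B : ℝ, ∀ k, ‖κbar k‖ ≤ B ∧ ‖μbar k‖ ≤ B)
    (ε : ℕ → ℝ) (hεanti : Antitone ε) (hεlim : Tendsto ε atTop (𝓝 0))
    (hin : ∀ k, rIn (D.aula (ρh k) (ρg k) (κbar k) (μbar k)) (w (k + 1)) ≤ ε k) :
    (∀ k, Metric.infDist 0
        (stationaritySet (D.aula (ρh k) (ρg k) (κbar k) (μbar k)) (w (k + 1)))
          ≤ Real.sqrt (Fintype.card (WIdx N n m)) * ε k) ∧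
    ∀ wstar : EuclideanSpace ℝ (WIdx N n m),
      MapClusterPt wstar atTop w → D.vertical.Feasible wstar → D.vertical.RCPLD wstar →
        D.vertical.MStationary wstar ∧ D.original.MStationary (xPart wstar) :=
  mainTheorem2_general D hD Sκ Sμ γ η hγ hη1 w κ κbar μ μbar ρh ρg hrun
    (hbdd.imp fun _ hB k i => (le_abs_self _).trans ((norm_le_pi_norm _ i).trans (hB k).2))
    ε hεlim hin
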